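/- Let $t\in\mathbb{C}$, $t\neq 0$, be not a root of unity, and let $u_1,u_2\in\mathbb{C}\setminus\{0\}$. For a parameter $q$ put $p=q/t$ and fix $p^{1/2}$. Consider two families of bosons $a^{(i)}_n$ ($i=1,2$, $n\in\mathbb{Z}\setminus\{0\}$) with $$[a^{(i)}_n,a^{(j)}_m]=n\,\frac{1-q^{|n|}}{1-t^{|n|}}\,\delta_{i,j}\,\delta_{n+m,0},$$ acting on the Fock module $\mathcal{F}_{\vec u}=\mathbb{C}[a^{(i)}_{-n}\;(i=1,2,\ n\geq 1)]\,|\vec u\rangle$ with $a^{(i)}_n|\vec u\rangle=0$ for $n\ge 1$; the spaces for different $q$ are identified through the monomials in the $a^{(i)}_{-n}$, and $b^{(i)}_n$ denotes the boson at $q=0$. Let $\langle\vec u|$ be the functional on $\mathcal{F}_{\vec u}$ with $\langle\vec u|\vec u\rangle=1$ and $\langle \vec u|a^{(i)}_{-n}=0$ for $n\geq 1$, and let $\mathcal{F}_{\vec u}^*$ be the space of all functionals $\langle\vec u|A$, $A$ in the algebra generated by the $b^{(i)}_n$. Put $$\eta^{(i)}(z)=\exp\Big(\sum_{n\ge1}\tfrac{1-t^{-n}}{n}z^na^{(i)}_{-n}\Big)\exp\Big(-\sum_{n\ge1}\tfrac{1-t^{n}}{n}z^{-n}a^{(i)}_{n}\Big),\qquad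 \varphi^{(1)}(z)=\exp\Big(\sum_{n\ge1}\tfrac{1-t^{-n}}{n}(1-p^{-n})z^na^{(1)}_{-n}\Big),$$ $$X^{(1)}(z)=\sum_{n\in\mathbb{Z}}X^{(1)}_nz^{-n}=u_1\,\eta^{(1)}(p^{1/2}z)+u_2\,\varphi^{(1)}(p^{1/2}z)\,\eta^{(2)}(p^{-1/2}z),\qquad X^{(2)}(z)=\sum_{n\in\mathbb{Z}}X^{(2)}_nz^{-n}=X^{(1)}(pz)X^{(1)}(z),$$ where the matrix elements of $X^{(1)}(w)X^{(1)}(z)$, which are expansions in $z/w$ of rational functions, are evaluated as rational functions at $w=pz$. Then the limits of operators on $\mathcal{F}_{\vec u}$ (taken matrix element by matrix element) $$\tilde X^{(1)}_n=\lim_{q\to0}p^{|n|/2}X^{(1)}_n,\qquad \tilde X^{(2)}_n=\lim_{q\to0}p^{n/2}X^{(2)}_n\qquad(n\in\mathbb{Z})$$ exist (and are unique). For pairs of partitions $\vec\lambda=(\lambda^{(1)},\lambda^{(2)})$ set $$|\tilde X_{\vec\lambda}\rangle=\tilde X^{(2)}_{-\lambda^{(2)}_1}\tilde X^{(2)}_{-\lambda^{(2)}_2}\cdots\tilde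 X^{(1)}_{-\lambda^{(1)}_1}\tilde X^{(1)}_{-\lambda^{(1)}_2}\cdots|\vec u\rangle,\qquad \langle\tilde X_{\vec\lambda}|=\langle\vec u|\cdots\tilde X^{(1)}_{\lambda^{(1)}_2}\tilde X^{(1)}_{\lambda^{(1)}_1}\cdots\tilde X^{(2)}_{\lambda^{(2)}_2}\tilde X^{(2)}_{\lambda^{(2)}_1}.$$ The vectors $|\tilde X_{\vec\lambda}\rangle$, with $\vec\lambda$ running over all pairs of partitions, form a basis of $\mathcal{F}_{\vec u}$, and the vectors $\langle\tilde X_{\vec\lambda}|$ form a basis of $\mathcal{F}_{\vec u}^*$. -/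

import Mathlib

open Filter Topology

namespace CrystalPBW

/-- The underlying space of the Fock module `F_u` for two families of bosons: polynomials in the
creation operators, where the variable `(i, n)` stands for `a^{(i)}_{-n}` and the vector `f` stands
for `f(a^{(i)}_{-n}) |u⟩`. The same underlying space is used for all values of `q`. -/
abbrev Fock : Type := MvPolynomial (Fin 2 × ℕ+) ℂ

/-- The linear operators on the Fock space. -/
abbrev Op : Type := Module.End ℂ Fock

/-- The highest weight vector `|u⟩`. -/
noncomputable def ketVac : Fock := 1

/-- The dual vector `⟨u|`, which kills the image of every creation operator, with `⟨u|u⟩ = 1`. -/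
noncomputable def braVac : Module.Dual ℂ Fock := MvPolynomial.lcoeff ℂ 0

/-- The creation operator `a^{(i)}_{-n}`, `n ≥ 1`. -/
noncomputable def creation (i : Fin 2) (n : ℕ+) : Op :=
  LinearMap.mulLeft ℂ (MvPolynomial.X (i, n) : Fock)

/-- The annihilation operator `a^{(i)}_n`, `n ≥ 1`, so that
`[a^{(i)}_n, a^{(j)}_{-m}] = n (1 - q^n) / (1 - t^n) δ_{ij} δ_{nm}` and `a^{(i)}_n |u⟩ = 0`.
For `q = 0` it is the boson `b^{(i)}_n`. -/
noncomputable def annihilation (t q : ℂ) (i : Fin 2) (n : ℕ+) : Op :=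
  (((n : ℕ) : ℂ) * (1 - q ^ (n : ℕ)) / (1 - t ^ (n : ℕ))) •
    (MvPolynomial.pderiv (R := ℂ) (i, n)).toLinearMap

/-- The dual Fock module `F_u^*`: the cyclic right module `⟨u| H` generated by `⟨u|` over the algebra
`H` that is generated by the bosons `b^{(i)}_n`, `n ≠ 0` (the bosons at `q = 0`). An operator acts on
a functional from the right by composition. -/
noncomputable def FockDual (t : ℂ) : Submodule ℂ (Module.Dual ℂ Fock) :=
  (Subalgebra.toSubmodule (Algebra.adjoin ℂ
    ((Set.range fun x : Fin 2 × ℕ+ => creation x.1 x.2) ∪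
      Set.range fun x : Fin 2 × ℕ+ => annihilation t 0 x.1 x.2))).map
    (LinearMap.llcomp ℂ Fock Fock ℂ braVac)

/-- `exp g = ∑_k g^k / k!` for an operator valued power series `g` without constant term; then
`g^k` does not contribute to the coefficient of order `m` for `k > m`. -/
noncomputable def expSeries (g : PowerSeries Op) : PowerSeries Op :=
  PowerSeries.mk fun m =>
    ∑ k ∈ Finset.range (m + 1), ((Nat.factorial k : ℂ)⁻¹) • PowerSeries.coeff m (g ^ k)

/-- The power series `∑_{n ≥ 1} c_n A_n x^n` without constant term. -/
noncomputable def current (c : ℕ → ℂ) (A : ℕ+ → Op) : PowerSeries Op :=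
  PowerSeries.mk fun n => if h : 0 < n then c n • A ⟨n, h⟩ else 0

/-- The creation part of `η^{(i)}(c z)`, as a power series in `z`:
`exp (∑_{n ≥ 1} (1 - t^{-n}) / n (c z)^n a^{(i)}_{-n})`. -/
noncomputable def etaCreation (t : ℂ) (i : Fin 2) (c : ℂ) : PowerSeries Op :=
  expSeries (current (fun n => (1 - (t ^ n)⁻¹) / n * c ^ n) (creation i))

/-- The annihilation part of `η^{(i)}(c z)`, as a power series in `z⁻¹`:
`exp (- ∑_{n ≥ 1} (1 - t^n) / n (c z)^{-n} a^{(i)}_n)`. -/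
noncomputable def etaAnnihilation (t q : ℂ) (i : Fin 2) (c : ℂ) : PowerSeries Op :=
  expSeries (current (fun n => -((1 - t ^ n) / n * (c ^ n)⁻¹)) (annihilation t q i))

/-- `φ^{(i)}(c z) = exp (∑_{n ≥ 1} (1 - t^{-n}) / n (1 - p^{-n}) (c z)^n a^{(i)}_{-n})`,
as a power series in `z`. -/
noncomputable def phi (t p : ℂ) (i : Fin 2) (c : ℂ) : PowerSeries Op :=
  expSeries (current (fun n => (1 - (t ^ n)⁻¹) / n * (1 - (p ^ n)⁻¹) * c ^ n) (creation i))

/-- The coefficient of `z^{-n}` in `A(z) B(z⁻¹) v`. When `B` is an exponential of annihilation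
operators only finitely many terms of this sum are nonzero. -/
noncomputable def mode (A B : PowerSeries Op) (n : ℤ) (v : Fock) : Fock :=
  ∑ᶠ x : {x : ℕ × ℕ // (x.2 : ℤ) - x.1 = n},
    PowerSeries.coeff x.1.1 A (PowerSeries.coeff x.1.2 B v)

/-- The action of `X^{(1)}_n` on `F_u`, `u = (u 0, u 1)`, where
`X^{(1)}(z) = ∑_n X^{(1)}_n z^{-n} = Λ^1(z) + Λ^2(z)` with `Λ^1(z) = η^{(1)}(p^{1/2} z) U_1` and
`Λ^2(z) = φ^{(1)}(p^{1/2} z) η^{(2)}(p^{-1/2} z) U_2`. The parameter is a square root `s` of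
`p = q / t`, so `p = s ^ 2` and `q = t * s ^ 2`; the operator `U_i` is the scalar `u_i` on `F_u`. -/
noncomputable def X1 (t : ℂ) (u : Fin 2 → ℂ) (s : ℂ) (n : ℤ) (v : Fock) : Fock :=
  u 0 • mode (etaCreation t 0 s) (etaAnnihilation t (t * s ^ 2) 0 s) n v +
  u 1 • mode (phi t (s ^ 2) 0 s * etaCreation t 1 s⁻¹)
    (etaAnnihilation t (t * s ^ 2) 1 s⁻¹) n v

/-- `x` is the value at `y` of the rational function `P / R` whose Laurent expansion at the origin is
`∑_k c_k y^k`. (The value is unique; it is the sum of the series wherever that converges absolutely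
and is its continuation elsewhere.) -/
def IsExpansionValue (c : ℤ → ℂ) (y x : ℂ) : Prop :=
  (∃ K : ℤ, ∀ k < K, c k = 0) ∧
  ∃ (R : Polynomial ℂ) (P : ℤ →₀ ℂ), R.eval y ≠ 0 ∧
    (∀ k : ℤ, (R.sum fun j r => r * c (k - j)) = P k) ∧
    x = (P.sum fun k a => a * y ^ k) / R.eval y

/-- `x` is the coefficient of the monomial `m` in `X^{(2)}_n v`, where
`X^{(2)}(z) = X^{(1)}(p z) X^{(1)}(z) = ∑_n X^{(2)}_n z^{-n}`, that is,
`X^{(2)}_n = ∑_k p^{-k} X^{(1)}_k X^{(1)}_{n-k}`. As usual, the matrix elements of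
`X^{(1)}(w) X^{(1)}(z)` are rational functions expanded in `z / w`, and the product at `w = p z` is
their value at `z / w = p⁻¹`. -/
def IsX2Coeff (t : ℂ) (u : Fin 2 → ℂ) (s : ℂ) (n : ℤ) (v : Fock) (m : Fin 2 × ℕ+ →₀ ℕ) (x : ℂ) :
    Prop :=
  IsExpansionValue (fun k => (X1 t u s k (X1 t u s (n - k) v)).coeff m) (s ^ 2)⁻¹ x

/-- `Y1 n` and `Y2 n` are the crystallized operators
`X̃^{(1)}_n = lim_{q → 0} p^{|n|/2} X^{(1)}_n` and `X̃^{(2)}_n = lim_{q → 0} p^{n/2} X^{(2)}_n`,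
limits of matrix elements with respect to the monomials in the creation operators; `q → 0`
is the same as `s → 0` for `s = p^{1/2}`. -/
structure IsCrystallization (t : ℂ) (u : Fin 2 → ℂ) (Y1 Y2 : ℤ → Op) : Prop where
  first : ∀ (n : ℤ) (v : Fock) (m : Fin 2 × ℕ+ →₀ ℕ),
    Tendsto (fun s : ℂ => s ^ n.natAbs * (X1 t u s n v).coeff m) (𝓝[≠] 0)
      (𝓝 ((Y1 n v).coeff m))
  second : ∀ (n : ℤ) (v : Fock) (m : Fin 2 × ℕ+ →₀ ℕ), ∃ x : ℂ → ℂ,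
    (∀ᶠ s in 𝓝[≠] (0 : ℂ), IsX2Coeff t u s n v m (x s)) ∧
    Tendsto (fun s : ℂ => s ^ n * x s) (𝓝[≠] 0) (𝓝 ((Y2 n v).coeff m))

/-- For a pair of partitions `l = (λ¹, λ²)`, the vector
`Y2_{-λ²_1} Y2_{-λ²_2} ⋯ Y1_{-λ¹_1} Y1_{-λ¹_2} ⋯ |u⟩`. A partition is given by its Young diagram,
`rowLens` is the list of its parts in decreasing order. -/
noncomputable def pbwKet (Y1 Y2 : ℤ → Op) (l : YoungDiagram × YoungDiagram) : Fock :=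
  ((l.2.rowLens.map fun k : ℕ => Y2 (-(k : ℤ))).prod *
    (l.1.rowLens.map fun k : ℕ => Y1 (-(k : ℤ))).prod) ketVac

/-- For a pair of partitions `l = (λ¹, λ²)`, the dual vector
`⟨u| ⋯ Y1_{λ¹_2} Y1_{λ¹_1} ⋯ Y2_{λ²_2} Y2_{λ²_1}`. -/
noncomputable def pbwBra (Y1 Y2 : ℤ → Op) (l : YoungDiagram × YoungDiagram) :
    Module.Dual ℂ Fock :=
  braVac ∘ₗ
    ((l.1.rowLens.reverse.map fun k : ℕ => Y1 (k : ℤ)).prod *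
      (l.2.rowLens.reverse.map fun k : ℕ => Y2 (k : ℤ)).prod)

end CrystalPBW

/-! All operators involved are built from modes of vertex operators exp(∑ α_n x_n z^n) exp(∑ β_n ∂_n
z^{-n}). The annihilation half is a translation of the variables and the creation half is
multiplication by the coefficients E_k of the first exponential, so on a fixed vector each mode is a
finite sum (`vertex`, `mode_eq_vertex`).

Limits. X^{(1)} is a combination of two such operators, Λ¹ and Λ². Rescaling z by s = p^{1/2} or its
inverse (`vertex_scale`) extracts s^{-n} from Λ¹ and s^n from Λ², and leaves exponents that are
regular at q = 0. Modes depend continuously on the exponents (`tendsto_vertex`), so after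
multiplication by s^{|n|} only Λ¹ survives for n > 0 and only Λ² for n < 0. In X^{(2)}, each product
of two vertex operators is a rational exchange factor in z/w times a normally ordered vertex
operator (`isExpansionValue_vertex_mul`). At w = pz the factor 1 - pz/w kills Λ¹Λ¹, Λ¹Λ² and Λ²Λ²,
while Λ²Λ¹ has exchange factor 1 (`isX2Coeff`). Hence X^{(2)} is a multiple of a single vertex
operator, whose rescaled limit creates only in the second family.

Basis. There is a Hall–Littlewood type triangularity: the mode of index -n, applied to a polynomial
in the E_k of the same vertex operator, multiplies it by E_n up to terms that contain some E_k with
k > n (`IsRaised.X_mul`). Applying modes in increasing order of the parts therefore gives monomials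
in the E_k plus larger monomials (`exists_isTriangular_prod`). The annihilation exponents of
X̃^{(2)} are orthogonal to the creation exponents of the surviving part of X̃^{(1)}, so the two
families of modes simply multiply. The E_k of the two operators freely generate the Fock space
because the 2×2 matrices of creation exponents are invertible (`bijective_creationHomPair`).
Together this is `vertexKet_basis`.

Dual. For the Fischer form, in which x and ∂ are adjoint, the adjoint of a vertex operator is the
vertex operator with α and β exchanged and z inverted (`isFischerAdjoint_vertex`). The dual module
is the image of the Fock space under this nondegenerate form (`fockDual_eq_range`), and the dual
vectors are the images of vectors covered by the same basis theorem. -/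

namespace CrystalPBW

/-! ### Formal exponentials over a noncommutative algebra. -/

section PexpRing
variable {A : Type*} [Ring A] [Algebra ℂ A]

/-- `exp g` for a power series `g` without constant term over a `ℂ`-algebra. -/
noncomputable def pexp (g : PowerSeries A) : PowerSeries A :=
  PowerSeries.mk fun m =>
    ∑ k ∈ Finset.range (m + 1), ((Nat.factorial k : ℂ)⁻¹) • PowerSeries.coeff m (g ^ k)

theorem expSeries_eq_pexp (g : PowerSeries Op) : expSeries g = pexp g := rfl

/-- The partial sums of the exponential series. -/
noncomputable def pexpTrunc (g : PowerSeries A) (N : ℕ) : PowerSeries A :=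
  ∑ k ∈ Finset.range N, ((Nat.factorial k : ℂ)⁻¹) • g ^ k

theorem coeff_pow_eq_zero {A : Type*} [Ring A] {g : PowerSeries A} (hg : PowerSeries.coeff 0 g = 0) :
    ∀ {k m : ℕ}, m < k → PowerSeries.coeff m (g ^ k) = 0
  | 0, m, h => absurd h (Nat.not_lt_zero m)
  | k + 1, m, h => by
    rw [pow_succ', PowerSeries.coeff_mul]
    refine Finset.sum_eq_zero fun x hx => ?_
    rw [Finset.HasAntidiagonal.mem_antidiagonal] at hx
    rcases Nat.eq_zero_or_pos x.1 with h0 | h0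
    · rw [h0, hg, zero_mul]
    · rw [coeff_pow_eq_zero hg (show x.2 < k by omega), mul_zero]

/-- Powers of `g` beyond the order in question do not contribute, so any larger cutoff may be used.
This turns identities between exponentials into identities between finite sums. -/
theorem coeff_pexp {g : PowerSeries A} (hg : PowerSeries.coeff 0 g = 0) {m N : ℕ} (h : m < N) :
    PowerSeries.coeff m (pexp g) = PowerSeries.coeff m (pexpTrunc g N) := by
  rw [pexp, PowerSeries.coeff_mk, pexpTrunc, map_sum]
  simp only [PowerSeries.coeff_smul]
  refine Finset.sum_subset (Finset.range_mono h) fun k _ hk => ?_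
  rw [coeff_pow_eq_zero hg (by simpa using hk), smul_zero]

theorem coeff_pexp_mul {g : PowerSeries A} (hg : PowerSeries.coeff 0 g = 0) {m N : ℕ} (h : m < N)
    (y : PowerSeries A) :
    PowerSeries.coeff m (pexp g * y) = PowerSeries.coeff m (pexpTrunc g N * y) := by
  rw [PowerSeries.coeff_mul, PowerSeries.coeff_mul]
  refine Finset.sum_congr rfl fun x hx => ?_
  rw [coeff_pexp hg (lt_of_le_of_lt (Finset.HasAntidiagonal.antidiagonal.fst_le hx) h)]

theorem coeff_mul_pexp {g : PowerSeries A} (hg : PowerSeries.coeff 0 g = 0) {m N : ℕ} (h : m < N)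
    (y : PowerSeries A) :
    PowerSeries.coeff m (y * pexp g) = PowerSeries.coeff m (y * pexpTrunc g N) := by
  rw [PowerSeries.coeff_mul, PowerSeries.coeff_mul]
  refine Finset.sum_congr rfl fun x hx => ?_
  rw [coeff_pexp hg (lt_of_le_of_lt (Finset.HasAntidiagonal.antidiagonal.snd_le hx) h)]

theorem coeff_zero_pexp (g : PowerSeries A) : PowerSeries.coeff 0 (pexp g) = 1 := by
  simp [pexp]

theorem pexp_zero : pexp (0 : PowerSeries A) = 1 := by
  ext m
  rw [coeff_pexp (by simp) (Nat.lt_succ_self m), pexpTrunc, Finset.sum_range_succ']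
  simp

theorem map_pexp {B : Type*} [Ring B] [Algebra ℂ B] (φ : A →ₐ[ℂ] B) (g : PowerSeries A) :
    PowerSeries.map (φ : A →+* B) (pexp g) = pexp (PowerSeries.map (φ : A →+* B) g) := by
  ext m
  simp only [pexp, PowerSeries.coeff_map, PowerSeries.coeff_mk, map_sum, ← map_pow]
  simp

theorem pow_mul_of_commutator {R : Type*} [Ring R] {g x c : R} (h : g * x = x * g + c)
    (hc : Commute c g) (k : ℕ) : g ^ k * x = x * g ^ k + k • (c * g ^ (k - 1)) := by
  induction k with
  | zero => simp
  | succ k ih =>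
    rw [pow_succ', mul_assoc, ih, mul_add, ← mul_assoc, h, mul_smul_comm, ← mul_assoc, ← hc.eq,
      mul_assoc c, add_mul, mul_assoc x]
    rcases k with _ | k
    · simp
    · simp only [Nat.add_sub_cancel, ← pow_succ']
      rw [add_assoc, succ_nsmul' _ (k + 1)]

/-- If [g, x] = c commutes with g, then g ↦ [g, x] acts like a derivative on powers of g, so [exp g,
x] = c exp g. -/
theorem pexp_mul_of_commutator {g x c : PowerSeries A} (hg : PowerSeries.coeff 0 g = 0)
    (h : g * x = x * g + c) (hc : Commute c g) : pexp g * x = x * pexp g + c * pexp g := by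
  ext m
  -- The last truncation is one shorter, because the commutator lowers the power of `g` by one.
  rw [map_add, coeff_pexp_mul hg (show m < m + 1 + 1 by omega),
    coeff_mul_pexp hg (show m < m + 1 + 1 by omega), coeff_mul_pexp hg (show m < m + 1 by omega),
    ← map_add]
  congr 1
  simp only [pexpTrunc, Finset.sum_mul, Finset.mul_sum, smul_mul_assoc, mul_smul_comm,
    pow_mul_of_commutator h hc, smul_add, Finset.sum_add_distrib]
  congr 1
  rw [Finset.sum_range_succ']
  simp only [Nat.add_sub_cancel, zero_smul, smul_zero, add_zero]
  refine Finset.sum_congr rfl fun k _ => ?_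
  rw [← Nat.cast_smul_eq_nsmul ℂ, smul_smul]
  congr 1
  rw [Nat.factorial_succ]
  push_cast
  have : ((k : ℂ) + 1) ≠ 0 := by exact_mod_cast Nat.succ_ne_zero k
  field_simp

end PexpRing

/-! ### Formal exponentials and logarithms over a commutative algebra, through differential
equations. -/

section PexpCommRing
variable {A : Type*} [CommRing A] [Algebra ℂ A]

open PowerSeries in
theorem derivative_pexp {g : PowerSeries A} (hg : PowerSeries.coeff 0 g = 0) :
    derivative A (pexp g) = derivative A g * pexp g := by
  ext m
  rw [coeff_mul_pexp hg (show m < m + 1 by omega), coeff_derivative,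
    coeff_pexp hg (show m + 1 < m + 1 + 1 by omega), ← coeff_derivative]
  congr 1
  rw [pexpTrunc, pexpTrunc, Finset.sum_range_succ', map_add, map_sum, Finset.mul_sum]
  have h0 : derivative A (((Nat.factorial 0 : ℂ)⁻¹) • g ^ 0) = 0 := by simp
  rw [h0, add_zero]
  refine Finset.sum_congr rfl fun k _ => ?_
  have h1 : ∀ (c : ℂ) (f : PowerSeries A), derivative A (c • f) = c • derivative A f := by
    intro c f
    ext n
    simp [coeff_derivative]
  rw [h1, Derivation.leibniz_pow, Nat.add_sub_cancel, ← Nat.cast_smul_eq_nsmul ℂ, smul_smul,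
    mul_smul_comm, smul_eq_mul, mul_comm (g ^ k)]
  congr 1
  rw [Nat.factorial_succ]
  push_cast
  have : ((k : ℂ) + 1) ≠ 0 := by exact_mod_cast Nat.succ_ne_zero k
  field_simp

theorem eq_zero_of_natCast_succ_mul {a : A} {n : ℕ} (h : a * ((n : A) + 1) = 0) : a = 0 := by
  have h1 : ((n : ℂ) + 1) • a = 0 := by
    rw [Algebra.smul_def, mul_comm]
    simpa using h
  exact (smul_eq_zero_iff_right (by exact_mod_cast Nat.succ_ne_zero n)).1 h1

open PowerSeries in
/-- A linear differential equation of first order has at most one solution with a given initial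
value. -/
theorem eq_of_derivative_eq_mul {h Y Z : PowerSeries A} (hY : derivative A Y = h * Y)
    (hZ : derivative A Z = h * Z) (h0 : coeff 0 Y = coeff 0 Z) : Y = Z := by
  ext m
  induction m using Nat.strong_induction_on with
  | _ m ih =>
    rcases m with _ | m
    · exact h0
    · have h1 : coeff m (derivative A Y) = coeff m (derivative A Z) := by
        rw [hY, hZ, coeff_mul, coeff_mul]
        refine Finset.sum_congr rfl fun x hx => ?_
        rw [ih x.2 (Nat.lt_succ_of_le (Finset.HasAntidiagonal.antidiagonal.snd_le hx))]
      rw [coeff_derivative, coeff_derivative] at h1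
      refine sub_eq_zero.1 (eq_zero_of_natCast_succ_mul (n := m) ?_)
      rw [sub_mul, h1, sub_self]

theorem eq_pexp {g Y : PowerSeries A} (hg : PowerSeries.coeff 0 g = 0)
    (hY : PowerSeries.derivative A Y = PowerSeries.derivative A g * Y)
    (h0 : PowerSeries.coeff 0 Y = 1) : Y = pexp g :=
  eq_of_derivative_eq_mul hY (derivative_pexp hg) (by rw [h0, coeff_zero_pexp])

/-- Both sides solve Y' = (g' + h') Y with constant term 1. -/
theorem pexp_add {g h : PowerSeries A} (hg : PowerSeries.coeff 0 g = 0)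
    (hh : PowerSeries.coeff 0 h = 0) : pexp (g + h) = pexp g * pexp h := by
  refine (eq_pexp (by rw [map_add, hg, hh, add_zero]) ?_ ?_).symm
  · rw [Derivation.leibniz, derivative_pexp hg, derivative_pexp hh, map_add, smul_eq_mul,
      smul_eq_mul]
    ring
  · simp [PowerSeries.coeff_mul, coeff_zero_pexp]

theorem isUnit_of_coeff_zero {A : Type*} [CommRing A] {e : PowerSeries A} (he : PowerSeries.coeff 0 e = 1) : IsUnit e := by
  rw [PowerSeries.isUnit_iff_constantCoeff, ← PowerSeries.coeff_zero_eq_constantCoeff_apply, he]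
  exact isUnit_one

theorem eq_of_derivative_eq {g h : PowerSeries A}
    (hD : PowerSeries.derivative A g = PowerSeries.derivative A h)
    (h0 : PowerSeries.coeff 0 g = PowerSeries.coeff 0 h) : g = h := by
  have h1 : g - h = 0 :=
    eq_of_derivative_eq_mul (h := 0) (by rw [map_sub, hD, sub_self, zero_mul]) (by simp)
      (by rw [map_sub, h0, sub_self, map_zero])
  exact sub_eq_zero.1 h1

theorem pexp_injective {g h : PowerSeries A} (hg : PowerSeries.coeff 0 g = 0)
    (hh : PowerSeries.coeff 0 h = 0) (H : pexp g = pexp h) : g = h := by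
  refine eq_of_derivative_eq ?_ (hg.trans hh.symm)
  have h1 := congrArg (PowerSeries.derivative A) H
  rw [derivative_pexp hg, derivative_pexp hh, ← H] at h1
  exact (isUnit_of_coeff_zero (coeff_zero_pexp g)).mul_right_cancel h1

/-- The logarithm is the formal integral of e'/e. -/
theorem exists_pexp_eq {e : PowerSeries A} (he : PowerSeries.coeff 0 e = 1) :
    ∃ g : PowerSeries A, PowerSeries.coeff 0 g = 0 ∧ pexp g = e := by
  obtain ⟨e', he'⟩ := (isUnit_of_coeff_zero he).exists_left_inv
  let d := PowerSeries.derivative A e * e'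
  -- At `n = 0` the convention `0⁻¹ = 0` makes the constant term vanish.
  let g : PowerSeries A := PowerSeries.mk fun n => ((n : ℂ)⁻¹) • PowerSeries.coeff (n - 1) d
  have hg : PowerSeries.coeff 0 g = 0 := by simp [g]
  have hd : PowerSeries.derivative A g = d := by
    ext m
    rw [PowerSeries.coeff_derivative, PowerSeries.coeff_mk, Nat.add_sub_cancel, smul_mul_assoc]
    have : ((m : ℂ) + 1) ≠ 0 := by exact_mod_cast Nat.succ_ne_zero m
    rw [show PowerSeries.coeff m d * ((m : A) + 1) = ((m : ℂ) + 1) • PowerSeries.coeff m d by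
      rw [Algebra.smul_def, mul_comm]; simp, smul_smul]
    push_cast
    rw [inv_mul_cancel₀ this, one_smul]
  refine ⟨g, hg, (eq_pexp hg ?_ he).symm⟩
  rw [hd, mul_assoc, he', mul_one]

theorem pexp_rescale (a : A) (g : PowerSeries A) :
    pexp (PowerSeries.rescale a g) = PowerSeries.rescale a (pexp g) := by
  ext m
  simp only [pexp, PowerSeries.coeff_mk, PowerSeries.coeff_rescale, ← map_pow, Finset.mul_sum,
    mul_smul_comm]

end PexpCommRing

/-- `exp (- ∑_{n ≥ 1} a^n x^n / n) = 1 - a x`. -/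
theorem pexp_neg_geometric (a : ℂ) :
    pexp (PowerSeries.mk fun n => -(a ^ n / n)) = 1 - PowerSeries.C a * PowerSeries.X := by
  have hg : PowerSeries.coeff 0 (PowerSeries.mk fun n : ℕ => -(a ^ n / n)) = (0 : ℂ) := by simp
  refine (eq_pexp hg ?_ (by simp)).symm
  have hd : PowerSeries.derivative ℂ (PowerSeries.mk fun n : ℕ => -(a ^ n / n)) =
      PowerSeries.mk fun n => -a ^ (n + 1) := by
    ext m
    rw [PowerSeries.coeff_derivative, PowerSeries.coeff_mk, PowerSeries.coeff_mk]
    have : ((m : ℂ) + 1) ≠ 0 := by exact_mod_cast Nat.succ_ne_zero m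
    push_cast
    field_simp
  rw [hd, mul_sub, mul_one, mul_comm (PowerSeries.C a), ← mul_assoc]
  ext m
  rcases m with _ | m
  · simp
  · simp [PowerSeries.coeff_mul_C, PowerSeries.coeff_succ_mul_X]
    ring

/-! ### Currents that mix both families of bosons. -/

section MixedCurrent
variable {A B : Type*} [Ring A] [Algebra ℂ A] [Ring B] [Algebra ℂ B]

/-- The power series `∑_{n ≥ 1} ∑_i α_{i,n} a_{i,n} z^n`. -/
noncomputable def mixedCurrent (α : Fin 2 × ℕ+ → ℂ) (a : Fin 2 × ℕ+ → A) : PowerSeries A :=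
  PowerSeries.mk fun n => if h : 0 < n then ∑ i : Fin 2, α (i, ⟨n, h⟩) • a (i, ⟨n, h⟩) else 0

theorem coeff_zero_mixedCurrent (α : Fin 2 × ℕ+ → ℂ) (a : Fin 2 × ℕ+ → A) :
    PowerSeries.coeff 0 (mixedCurrent α a) = 0 := by
  simp [mixedCurrent]

theorem coeff_mixedCurrent (α : Fin 2 × ℕ+ → ℂ) (a : Fin 2 × ℕ+ → A) (n : ℕ+) :
    PowerSeries.coeff n (mixedCurrent α a) = ∑ i : Fin 2, α (i, n) • a (i, n) := by
  rw [mixedCurrent, PowerSeries.coeff_mk, dif_pos n.pos]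
  rfl

theorem ext_mixedCurrent {A : Type*} [Semiring A] {g h : PowerSeries A}
    (h0 : PowerSeries.coeff 0 g = PowerSeries.coeff 0 h)
    (hn : ∀ n : ℕ+, PowerSeries.coeff n g = PowerSeries.coeff n h) : g = h := by
  ext n
  rcases Nat.eq_zero_or_pos n with rfl | hpos
  · exact h0
  · exact hn ⟨n, hpos⟩

theorem map_mixedCurrent (φ : A →ₐ[ℂ] B) (α : Fin 2 × ℕ+ → ℂ) (a : Fin 2 × ℕ+ → A) :
    PowerSeries.map (φ : A →+* B) (mixedCurrent α a) = mixedCurrent α fun x => φ (a x) := by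
  refine ext_mixedCurrent ?_ fun n => ?_
  · simp [mixedCurrent]
  · simp only [PowerSeries.coeff_map, coeff_mixedCurrent, map_sum]
    simp

theorem mixedCurrent_add_left (α β : Fin 2 × ℕ+ → ℂ) (a : Fin 2 × ℕ+ → A) :
    mixedCurrent (α + β) a = mixedCurrent α a + mixedCurrent β a := by
  refine ext_mixedCurrent ?_ fun n => ?_
  · simp [mixedCurrent]
  · simp only [map_add, coeff_mixedCurrent, Pi.add_apply, add_smul, Finset.sum_add_distrib]

theorem mixedCurrent_add_right (α : Fin 2 × ℕ+ → ℂ) (a b : Fin 2 × ℕ+ → A) :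
    mixedCurrent α (a + b) = mixedCurrent α a + mixedCurrent α b := by
  refine ext_mixedCurrent ?_ fun n => ?_
  · simp [mixedCurrent]
  · simp only [map_add, coeff_mixedCurrent, Pi.add_apply, smul_add, Finset.sum_add_distrib]

theorem current_eq_mixedCurrent (c : ℕ → ℂ) (i : Fin 2) (a : Fin 2 × ℕ+ → Op) :
    current c (fun n => a (i, n)) =
      mixedCurrent (fun x => if x.1 = i then c x.2 else 0) a := by
  refine ext_mixedCurrent ?_ fun n => ?_
  · simp [mixedCurrent, current]
  · rw [coeff_mixedCurrent, current, PowerSeries.coeff_mk, dif_pos n.pos]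
    simp
    rfl

end MixedCurrent

/-! ### Vertex operators as a translation followed by a contraction. -/

/-- `exp (∑_{n ≥ 1} ∑_i α_{i,n} x_{i,n} z^n)` for the variables `x_{i,n}` of the Fock space. -/
noncomputable def creationSeries (α : Fin 2 × ℕ+ → ℂ) : PowerSeries Fock :=
  pexp (mixedCurrent α MvPolynomial.X)

/-- The coefficient of `z^k`, `k ∈ ℤ`, in `creationSeries α`. -/
noncomputable def creationCoeff (α : Fin 2 × ℕ+ → ℂ) (k : ℤ) : Fock :=
  if 0 ≤ k then PowerSeries.coeff k.toNat (creationSeries α) else 0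

theorem creationCoeff_natCast (α : Fin 2 × ℕ+ → ℂ) (n : ℕ) :
    creationCoeff α n = PowerSeries.coeff n (creationSeries α) := by
  simp [creationCoeff]

theorem creationCoeff_of_neg (α : Fin 2 × ℕ+ → ℂ) {k : ℤ} (hk : k < 0) :
    creationCoeff α k = 0 := by
  simp [creationCoeff, hk]

theorem creationCoeff_zero (α : Fin 2 × ℕ+ → ℂ) : creationCoeff α 0 = 1 := by
  simpa [creationSeries, coeff_zero_pexp] using creationCoeff_natCast α 0

/-- The substitution `x_{i,n} ↦ x_{i,n} + β_{i,n} w^n`. -/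
noncomputable def shift (β : Fin 2 × ℕ+ → ℂ) : Fock →ₐ[ℂ] Polynomial Fock :=
  MvPolynomial.aeval fun x =>
    Polynomial.C (MvPolynomial.X x) + Polynomial.monomial (x.2 : ℕ) (MvPolynomial.C (β x))

theorem shift_X (β : Fin 2 × ℕ+ → ℂ) (x : Fin 2 × ℕ+) :
    shift β (MvPolynomial.X x) =
      Polynomial.C (MvPolynomial.X x) + Polynomial.monomial (x.2 : ℕ) (MvPolynomial.C (β x)) := by
  simp [shift]

/-- `exp (∑_{n ≥ 1} ∑_i β_{i,n} ∂_{i,n} w^n)` for the derivatives `∂_{i,n}` on the Fock space. -/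
noncomputable def annihilationSeries (β : Fin 2 × ℕ+ → ℂ) : PowerSeries Op :=
  pexp (mixedCurrent β fun x => (MvPolynomial.pderiv (R := ℂ) x).toLinearMap)

/-- The linear map `w^b f ↦ E_{b-n} f`, where `E_k` are the coefficients of `creationSeries α`. -/
noncomputable def contract (α : Fin 2 × ℕ+ → ℂ) (n : ℤ) : Polynomial Fock →ₗ[Fock] Fock :=
  Polynomial.lsum fun b => LinearMap.mulLeft Fock (creationCoeff α (b - n))

/-- The coefficient of `z^{-n}` in the vertex operator
`exp (∑ α_{i,n} x_{i,n} z^n) exp (∑ β_{i,n} ∂_{i,n} z^{-n})`. -/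
noncomputable def vertex (α β : Fin 2 × ℕ+ → ℂ) (n : ℤ) : Op :=
  (contract α n).restrictScalars ℂ ∘ₗ (shift β).toLinearMap

theorem vertex_apply (α β : Fin 2 × ℕ+ → ℂ) (n : ℤ) (v : Fock) :
    vertex α β n v = contract α n (shift β v) := rfl

theorem contract_apply (α : Fin 2 × ℕ+ → ℂ) (n : ℤ) (p : Polynomial Fock) :
    contract α n p = p.sum fun b f => creationCoeff α (b - n) * f := rfl

theorem contract_eq_sum_range (α : Fin 2 × ℕ+ → ℂ) (n : ℤ) (p : Polynomial Fock) {N : ℕ}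
    (hN : p.natDegree < N) :
    contract α n p = ∑ b ∈ Finset.range N, creationCoeff α (b - n) * p.coeff b := by
  rw [contract_apply, Polynomial.sum_over_range' p (fun b => by simp) N hN]

theorem contract_monomial (α : Fin 2 × ℕ+ → ℂ) (n : ℤ) (b : ℕ) (f : Fock) :
    contract α n (Polynomial.monomial b f) = creationCoeff α (b - n) * f := by
  rw [contract_apply, Polynomial.sum_monomial_index _ _ (by simp)]

theorem contract_mul_X_pow (α : Fin 2 × ℕ+ → ℂ) (n : ℤ) (j : ℕ) (p : Polynomial Fock) :
    contract α n (p * Polynomial.X ^ j) = contract α (n - j) p := by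
  induction p using Polynomial.induction_on' with
  | add p q hp hq => rw [add_mul, map_add, map_add, hp, hq]
  | monomial b f =>
    rw [Polynomial.monomial_mul_X_pow, contract_monomial, contract_monomial]
    congr 2
    push_cast
    ring

/-! ### Comparison of the operator-valued exponentials with vertex operators. -/

section Modes

theorem creation_eq_lmul (x : Fin 2 × ℕ+) :
    creation x.1 x.2 = Algebra.lmul ℂ Fock (MvPolynomial.X x) := by
  ext1; rfl

theorem expSeries_creation (α : Fin 2 × ℕ+ → ℂ) :
    expSeries (mixedCurrent α fun x => creation x.1 x.2) =
      PowerSeries.map (Algebra.lmul ℂ Fock : Fock →+* Op) (creationSeries α) := by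
  rw [expSeries_eq_pexp, creationSeries, map_pexp, map_mixedCurrent]
  simp only [creation_eq_lmul]

theorem creationSeries_add (α β : Fin 2 × ℕ+ → ℂ) :
    creationSeries (α + β) = creationSeries α * creationSeries β := by
  rw [creationSeries, mixedCurrent_add_left,
    pexp_add (coeff_zero_mixedCurrent _ _) (coeff_zero_mixedCurrent _ _)]
  rfl

theorem pderiv_mul_lmul_X (x y : Fin 2 × ℕ+) :
    ((MvPolynomial.pderiv (R := ℂ) x).toLinearMap : Op) * Algebra.lmul ℂ Fock (MvPolynomial.X y) =
      Algebra.lmul ℂ Fock (MvPolynomial.X y) * (MvPolynomial.pderiv (R := ℂ) x).toLinearMap +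
        (if x = y then 1 else 0 : Op) := by
  refine LinearMap.ext fun v => ?_
  rcases eq_or_ne x y with rfl | h
  · simp [Derivation.leibniz]
  · simp [Derivation.leibniz, h, MvPolynomial.pderiv_X_of_ne (Ne.symm h)]

theorem mixedCurrent_pderiv_mul_X (β : Fin 2 × ℕ+ → ℂ) (y : Fin 2 × ℕ+) :
    mixedCurrent β (fun x => ((MvPolynomial.pderiv (R := ℂ) x).toLinearMap : Op)) *
        PowerSeries.C (Algebra.lmul ℂ Fock (MvPolynomial.X y)) =
      PowerSeries.C (Algebra.lmul ℂ Fock (MvPolynomial.X y)) *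
        mixedCurrent β (fun x => ((MvPolynomial.pderiv (R := ℂ) x).toLinearMap : Op)) +
        β y • PowerSeries.X ^ (y.2 : ℕ) := by
  refine ext_mixedCurrent ?_ fun n => ?_
  · simp [mixedCurrent]
  · rw [map_add, PowerSeries.coeff_mul_C, PowerSeries.coeff_C_mul, coeff_mixedCurrent,
      Finset.sum_mul, Finset.mul_sum]
    simp only [smul_mul_assoc, mul_smul_comm, pderiv_mul_lmul_X, smul_add, Finset.sum_add_distrib]
    congr 1
    rw [PowerSeries.coeff_smul, PowerSeries.coeff_X_pow]
    obtain ⟨i, m⟩ := y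
    rcases eq_or_ne n m with rfl | h
    · simp
    · simp [h]

theorem coeff_pexp_pderiv_mul_X (β : Fin 2 × ℕ+ → ℂ) (y : Fin 2 × ℕ+) (m : ℕ) (v : Fock) :
    PowerSeries.coeff m (annihilationSeries β) (v * MvPolynomial.X y) =
      PowerSeries.coeff m (annihilationSeries β) v * MvPolynomial.X y +
      if (y.2 : ℕ) ≤ m then β y • PowerSeries.coeff (m - y.2) (annihilationSeries β) v else 0 := by
  have h := pexp_mul_of_commutator (coeff_zero_mixedCurrent _ _) (mixedCurrent_pderiv_mul_X β y)
    (((PowerSeries.commute_X_pow _ _).symm).smul_left (β y))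
  rw [← annihilationSeries] at h
  have h1 : ∀ f g : PowerSeries Op, f = g →
      PowerSeries.coeff m f v = PowerSeries.coeff m g v := fun f g h => by rw [h]
  replace h1 := h1 _ _ h
  simp only [PowerSeries.coeff_mul_C, map_add, PowerSeries.coeff_C_mul, smul_mul_assoc,
    PowerSeries.coeff_smul, PowerSeries.coeff_X_pow_mul', LinearMap.add_apply,
    LinearMap.smul_apply, Module.End.mul_apply] at h1
  rw [mul_comm v, mul_comm _ (MvPolynomial.X y)]
  refine h1.trans ?_
  split_ifs <;> simp

theorem coeff_pexp_pderiv_C (β : Fin 2 × ℕ+ → ℂ) (m : ℕ) (a : ℂ) :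
    PowerSeries.coeff m (annihilationSeries β) (MvPolynomial.C a) =
      if m = 0 then MvPolynomial.C a else 0 := by
  rw [annihilationSeries, coeff_pexp (coeff_zero_mixedCurrent _ _) (Nat.lt_succ_self m), pexpTrunc,
    Finset.sum_range_succ', map_add, LinearMap.add_apply, map_sum, LinearMap.sum_apply]
  rw [Finset.sum_eq_zero, zero_add]
  · simp only [Nat.factorial_zero, Nat.cast_one, inv_one, pow_zero, one_smul,
      PowerSeries.coeff_one]
    split_ifs <;> simp
  · intro k _
    rw [PowerSeries.coeff_smul, pow_succ, PowerSeries.coeff_mul, LinearMap.smul_apply,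
      LinearMap.sum_apply, Finset.sum_eq_zero, smul_zero]
    intro x _
    rw [Module.End.mul_apply]
    refine (congrArg _ ?_).trans (map_zero _)
    rcases Nat.eq_zero_or_pos x.2 with h | h
    · rw [h, coeff_zero_mixedCurrent, LinearMap.zero_apply]
    · lift x.2 to ℕ+ using h with n
      rw [coeff_mixedCurrent]
      simp

/-- Taylor's formula: the exponential of a constant-coefficient derivation is a translation. Both
sides agree on constants and obey the same recursion under multiplication by a variable. -/
theorem coeff_pexp_pderiv (β : Fin 2 × ℕ+ → ℂ) (m : ℕ) (v : Fock) :
    PowerSeries.coeff m (annihilationSeries β) v = (shift β v).coeff m := by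
  induction v using MvPolynomial.induction_on generalizing m with
  | C a =>
    rw [coeff_pexp_pderiv_C]
    rw [show shift β (MvPolynomial.C a) = Polynomial.C (MvPolynomial.C a) from
      (shift β).commutes a, Polynomial.coeff_C]
  | add p q hp hq => rw [map_add, map_add, hp, hq, Polynomial.coeff_add]
  | mul_X p y hp =>
    rw [coeff_pexp_pderiv_mul_X, hp, map_mul, shift_X, mul_add, Polynomial.coeff_add,
      Polynomial.coeff_mul_C,
      ← Polynomial.C_mul_X_pow_eq_monomial, ← mul_assoc, Polynomial.coeff_mul_X_pow',
      Polynomial.coeff_mul_C]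
    congr 1
    split_ifs
    · rw [hp, mul_comm, MvPolynomial.smul_eq_C_mul]
    · rfl

/-- The pair of orders is determined by the annihilation order b. The terms missing from the finite
sum vanish because the translated vector is a polynomial in w, and the terms with b < n because the
creation coefficients of negative index are zero. -/
theorem mode_eq_vertex {a b : PowerSeries Op} {α β : Fin 2 × ℕ+ → ℂ}
    (ha : a = PowerSeries.map (Algebra.lmul ℂ Fock : Fock →+* Op) (creationSeries α))
    (hb : b = annihilationSeries β)
    (n : ℤ) (v : Fock) : mode a b n v = vertex α β n v := by
  subst ha hb
  rw [mode]
  have hinj : Function.Injective fun x : {x : ℕ × ℕ // (x.2 : ℤ) - x.1 = n} => x.1.2 := by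
    rintro ⟨⟨a, b⟩, h⟩ ⟨⟨a', b'⟩, h'⟩ (hab : b = b')
    simp only [Subtype.mk.injEq, Prod.mk.injEq]
    simp only at h h'
    omega
  have h1 : ∀ x : {x : ℕ × ℕ // (x.2 : ℤ) - x.1 = n},
      PowerSeries.coeff x.1.1
          (PowerSeries.map (Algebra.lmul ℂ Fock : Fock →+* Op) (creationSeries α))
        (PowerSeries.coeff x.1.2 (annihilationSeries β) v) =
      (fun b : ℕ => creationCoeff α (b - n) * (shift β v).coeff b) x.1.2 := by
    rintro ⟨⟨a, b⟩, h⟩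
    simp only at h ⊢
    rw [coeff_pexp_pderiv, show (b : ℤ) - n = (a : ℕ) by omega, creationCoeff_natCast]
    simp
  rw [finsum_congr h1, ← finsum_mem_range (f := fun b : ℕ =>
      creationCoeff α (b - n) * (shift β v).coeff b) hinj, vertex_apply, contract_apply,
    Polynomial.sum_def, ← finsum_mem_coe_finset]
  refine finsum_mem_inter_support_eq _ _ _ (Set.ext fun b => ?_)
  simp only [Set.mem_inter_iff, Set.mem_range, Function.mem_support, Subtype.exists, Prod.exists,
    Finset.mem_coe, Polynomial.mem_support_iff]
  constructor
  · rintro ⟨_, h⟩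
    exact ⟨right_ne_zero_of_mul h, h⟩
  · rintro ⟨_, h⟩
    have h2 : 0 ≤ (b : ℤ) - n := by
      by_contra h3
      exact left_ne_zero_of_mul h (creationCoeff_of_neg α (not_le.1 h3))
    exact ⟨⟨((b : ℤ) - n).toNat, b, by omega, rfl⟩, h⟩

end Modes

/-! ### Moving an annihilation part through a creation part. -/

section Exchange

/-- The scalar series `exp (∑_{n ≥ 1} ∑_i β_{i,n} α_{i,n} x^n)` that arises from moving the
annihilation part of one vertex operator through the creation part of another one. -/
noncomputable def exchangeFactor (β α : Fin 2 × ℕ+ → ℂ) : PowerSeries ℂ :=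
  pexp (mixedCurrent (β * α) 1)

theorem coeff_zero_exchangeFactor (β α : Fin 2 × ℕ+ → ℂ) :
    PowerSeries.coeff 0 (exchangeFactor β α) = 1 := coeff_zero_pexp _

theorem exchangeFactor_eq_one {β α : Fin 2 × ℕ+ → ℂ} (h : ∀ n, ∑ i, β (i, n) * α (i, n) = 0) :
    exchangeFactor β α = 1 := by
  rw [exchangeFactor, show mixedCurrent (β * α) (1 : Fin 2 × ℕ+ → ℂ) = 0 from
    ext_mixedCurrent (by simp [mixedCurrent]) fun n => by
      rw [coeff_mixedCurrent]; simpa using h n, pexp_zero]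

/-- Translation adds a scalar series in the product of the two formal variables to the exponent, so
the exponential splits into a product. -/
theorem map_shift_creationSeries (β α : Fin 2 × ℕ+ → ℂ) :
    PowerSeries.map (shift β : Fock →+* Polynomial Fock) (creationSeries α) =
      PowerSeries.map (Polynomial.C : Fock →+* Polynomial Fock) (creationSeries α) *
        PowerSeries.rescale (Polynomial.X : Polynomial Fock)
          (PowerSeries.map (algebraMap ℂ (Polynomial Fock)) (exchangeFactor β α)) := by
  have h1 : PowerSeries.map (Polynomial.C : Fock →+* Polynomial Fock) (creationSeries α) =
      pexp (mixedCurrent α fun x => Polynomial.C (MvPolynomial.X x : Fock)) := by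
    have := map_pexp (Polynomial.CAlgHom (R := ℂ) (A := Fock)) (mixedCurrent α MvPolynomial.X)
    rw [map_mixedCurrent] at this
    exact this
  have h2 : PowerSeries.rescale (Polynomial.X : Polynomial Fock)
          (PowerSeries.map (algebraMap ℂ (Polynomial Fock)) (exchangeFactor β α)) =
      pexp (mixedCurrent α fun x =>
        Polynomial.monomial (x.2 : ℕ) (MvPolynomial.C (β x) : Fock)) := by
    have := map_pexp (Algebra.ofId ℂ (Polynomial Fock)) (mixedCurrent (β * α) 1)
    rw [exchangeFactor]
    refine (congrArg _ this).trans ?_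
    rw [← pexp_rescale, map_mixedCurrent]
    congr 1
    refine ext_mixedCurrent ?_ fun n => ?_
    · simp [mixedCurrent]
    · rw [PowerSeries.coeff_rescale, coeff_mixedCurrent, coeff_mixedCurrent, Finset.mul_sum]
      refine Finset.sum_congr rfl fun i _ => ?_
      simp only [Pi.mul_apply, Pi.one_apply, map_one, mul_smul_comm, mul_one]
      rw [← Polynomial.C_mul_X_pow_eq_monomial, mul_comm, mul_smul]
      congr 1
      rw [Algebra.smul_def]
      rfl
  rw [h1, h2, ← pexp_add (coeff_zero_mixedCurrent _ _) (coeff_zero_mixedCurrent _ _),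
    ← mixedCurrent_add_right, creationSeries, map_pexp, map_mixedCurrent]
  simp only [shift_X]
  rfl

theorem shift_creationCoeff (β α : Fin 2 × ℕ+ → ℂ) {k : ℤ} {N : ℕ} (hN : k < N) :
    shift β (creationCoeff α k) = ∑ j ∈ Finset.range N,
      Polynomial.C (PowerSeries.coeff j (exchangeFactor β α) • creationCoeff α (k - j)) *
        Polynomial.X ^ j := by
  rcases lt_or_ge k 0 with hk | hk
  · rw [creationCoeff_of_neg α hk, map_zero, Finset.sum_eq_zero]
    intro j _
    rw [creationCoeff_of_neg α (by omega), smul_zero, map_zero, zero_mul]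
  · lift k to ℕ using hk
    rw [creationCoeff_natCast]
    have h := congrArg (PowerSeries.coeff k) (map_shift_creationSeries β α)
    rw [PowerSeries.coeff_map] at h
    refine h.trans ?_
    rw [mul_comm, PowerSeries.coeff_mul, Finset.Nat.sum_antidiagonal_eq_sum_range_succ_mk]
    rw [← Finset.sum_subset (Finset.range_mono (show k + 1 ≤ N by omega))]
    · refine Finset.sum_congr rfl fun j hj => ?_
      have hj : j ≤ k := by simpa [Nat.lt_succ_iff] using hj
      rw [show (k : ℤ) - j = (k - j : ℕ) by omega, creationCoeff_natCast]
      simp only [PowerSeries.coeff_rescale, PowerSeries.coeff_map]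
      rw [mul_comm, mul_comm (Polynomial.X ^ j), ← mul_assoc]
      congr 1
      rw [mul_comm, ← Algebra.smul_def]
      exact Polynomial.smul_C _ _
    · intro j _ hj
      rw [creationCoeff_of_neg α (by simp at hj; omega), smul_zero, map_zero, zero_mul]

/-- This is the exchange relation in modes. It serves both the computation of products of vertex
operators and the triangularity argument. -/
theorem vertex_creationCoeff_mul (α β α' : Fin 2 × ℕ+ → ℂ) (n : ℤ) {k : ℤ} {N : ℕ} (hN : k < N)
    (v : Fock) : vertex α β n (creationCoeff α' k * v) = ∑ j ∈ Finset.range N,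
      PowerSeries.coeff j (exchangeFactor β α') •
        (creationCoeff α' (k - j) * vertex α β (n - j) v) := by
  rw [vertex_apply, map_mul, shift_creationCoeff β α' hN, Finset.sum_mul, map_sum]
  refine Finset.sum_congr rfl fun j _ => ?_
  rw [mul_assoc, mul_comm (Polynomial.X ^ j), ← Polynomial.smul_eq_C_mul, map_smul,
    contract_mul_X_pow, vertex_apply, smul_eq_mul, smul_mul_assoc]

end Exchange

/-! ### Rescaling of the formal variable. -/

section Scaling

theorem creationCoeff_scale (α : Fin 2 × ℕ+ → ℂ) {s : ℂ} (k : ℤ) :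
    creationCoeff (fun x => s ^ (x.2 : ℕ) * α x) k = s ^ k.toNat • creationCoeff α k := by
  rcases lt_or_ge k 0 with hk | hk
  · rw [creationCoeff_of_neg _ hk, creationCoeff_of_neg _ hk, smul_zero]
  · lift k to ℕ using hk
    rw [creationCoeff_natCast, creationCoeff_natCast, Int.toNat_natCast]
    have h : creationSeries (fun x => s ^ (x.2 : ℕ) * α x) =
        PowerSeries.rescale (MvPolynomial.C s) (creationSeries α) := by
      rw [creationSeries, creationSeries, ← pexp_rescale]
      congr 1
      refine ext_mixedCurrent (by simp [mixedCurrent]) fun n => ?_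
      rw [PowerSeries.coeff_rescale, coeff_mixedCurrent, coeff_mixedCurrent, Finset.mul_sum]
      refine Finset.sum_congr rfl fun i _ => ?_
      rw [← map_pow, ← MvPolynomial.smul_eq_C_mul, smul_smul]
    rw [h, PowerSeries.coeff_rescale, ← map_pow, ← MvPolynomial.smul_eq_C_mul]

theorem shift_X_mul_coeff (β : Fin 2 × ℕ+ → ℂ) (x : Fin 2 × ℕ+) (v : Fock) (b : ℕ) :
    (shift β (v * MvPolynomial.X x)).coeff b =
      (shift β v).coeff b * MvPolynomial.X x +
        if (x.2 : ℕ) ≤ b then β x • (shift β v).coeff (b - x.2) else 0 := by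
  simpa only [coeff_pexp_pderiv] using coeff_pexp_pderiv_mul_X β x b v

theorem shift_C (β : Fin 2 × ℕ+ → ℂ) (a : ℂ) :
    shift β (MvPolynomial.C a) = Polynomial.C (MvPolynomial.C a) := (shift β).commutes a

theorem coeff_shift_scale (β : Fin 2 × ℕ+ → ℂ) (s : ℂ) (v : Fock) (b : ℕ) :
    (shift (fun x => s ^ (x.2 : ℕ) * β x) v).coeff b = s ^ b • (shift β v).coeff b := by
  induction v using MvPolynomial.induction_on generalizing b with
  | C a =>
    rw [shift_C, shift_C, Polynomial.coeff_C]
    split_ifs with h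
    · simp [h]
    · rw [smul_zero]
  | add p q hp hq =>
    rw [map_add, map_add, Polynomial.coeff_add, Polynomial.coeff_add, hp, hq, smul_add]
  | mul_X p x hp =>
    rw [shift_X_mul_coeff, shift_X_mul_coeff, hp, smul_add, smul_mul_assoc]
    congr 1
    split_ifs with h
    · rw [hp, smul_smul, smul_smul, mul_right_comm, ← pow_add, Nat.add_sub_cancel' h]
    · rw [smul_zero]

/-- The bound is uniform in β, so modes with varying exponents can be written as sums over one fixed
range. -/
theorem exists_natDegree_shift_lt (v : Fock) :
    ∃ N, ∀ β : Fin 2 × ℕ+ → ℂ, (shift β v).natDegree < N := by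
  induction v using MvPolynomial.induction_on with
  | C a => exact ⟨1, fun β => by rw [shift_C, Polynomial.natDegree_C]; exact Nat.one_pos⟩
  | add p q hp hq =>
    obtain ⟨N, hN⟩ := hp
    obtain ⟨M, hM⟩ := hq
    refine ⟨max N M, fun β => ?_⟩
    rw [map_add]
    exact (Polynomial.natDegree_add_le _ _).trans_lt (max_lt_max (hN β) (hM β))
  | mul_X p x hp =>
    obtain ⟨N, hN⟩ := hp
    refine ⟨N + x.2, fun β => ?_⟩
    rw [map_mul, shift_X]
    refine Polynomial.natDegree_mul_le.trans_lt (add_lt_add_of_lt_of_le (hN β) ?_)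
    refine (Polynomial.natDegree_add_le _ _).trans (max_le ?_ (Polynomial.natDegree_monomial_le _))
    rw [Polynomial.natDegree_C]
    exact Nat.zero_le _

theorem vertex_scale (α β : Fin 2 × ℕ+ → ℂ) {s : ℂ} (hs : s ≠ 0) (n : ℤ) (v : Fock) :
    vertex (fun x => s ^ (x.2 : ℕ) * α x) (fun x => s⁻¹ ^ (x.2 : ℕ) * β x) n v =
      s ^ (-n) • vertex α β n v := by
  obtain ⟨N, hN⟩ := exists_natDegree_shift_lt v
  rw [vertex_apply, vertex_apply, contract_eq_sum_range _ _ _ (hN _),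
    contract_eq_sum_range _ _ _ (hN _), Finset.smul_sum]
  refine Finset.sum_congr rfl fun b _ => ?_
  rw [creationCoeff_scale, coeff_shift_scale, smul_mul_smul_comm]
  rcases lt_or_ge ((b : ℤ) - n) 0 with h | h
  -- Here `toNat` would give the wrong power of `s`, but the creation coefficient is zero.
  · simp [creationCoeff_of_neg _ h]
  · congr 1
    rw [← zpow_natCast, Int.toNat_of_nonneg h, inv_pow, ← zpow_natCast, ← zpow_neg,
      ← zpow_add₀ hs]
    congr 1
    ring

end Scaling

/-! ### Coefficientwise continuity in the exponents. -/

section Continuity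
variable {ι : Type*} {l : Filter ι}

theorem tendsto_coeff_mul {f g : ι → Fock} {f₀ g₀ : Fock}
    (hf : ∀ m, Tendsto (fun s => (f s).coeff m) l (𝓝 (f₀.coeff m)))
    (hg : ∀ m, Tendsto (fun s => (g s).coeff m) l (𝓝 (g₀.coeff m))) (m : Fin 2 × ℕ+ →₀ ℕ) :
    Tendsto (fun s => (f s * g s).coeff m) l (𝓝 ((f₀ * g₀).coeff m)) := by
  simp only [MvPolynomial.coeff_mul]
  exact tendsto_finsetSum _ fun x _ => (hf _).mul (hg _)

theorem tendsto_coeff_sum {κ : Type*} (S : Finset κ) {f : κ → ι → Fock} {f₀ : κ → Fock}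
    (hf : ∀ k ∈ S, ∀ m, Tendsto (fun s => (f k s).coeff m) l (𝓝 ((f₀ k).coeff m)))
    (m : Fin 2 × ℕ+ →₀ ℕ) :
    Tendsto (fun s => (∑ k ∈ S, f k s).coeff m) l (𝓝 ((∑ k ∈ S, f₀ k).coeff m)) := by
  simp only [MvPolynomial.coeff_sum]
  exact tendsto_finsetSum _ fun x hx => hf x hx m

theorem tendsto_coeff_smul {c : ι → ℂ} {c₀ : ℂ} (hc : Tendsto c l (𝓝 c₀)) {f : ι → Fock} {f₀ : Fock}
    (hf : ∀ m, Tendsto (fun s => (f s).coeff m) l (𝓝 (f₀.coeff m))) (m : Fin 2 × ℕ+ →₀ ℕ) :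
    Tendsto (fun s => (c s • f s).coeff m) l (𝓝 ((c₀ • f₀).coeff m)) := by
  simp only [MvPolynomial.coeff_smul]
  exact hc.smul (hf m)

theorem tendsto_coeff_pow {g : ι → PowerSeries Fock} {g₀ : PowerSeries Fock}
    (hg : ∀ n m, Tendsto (fun s => (PowerSeries.coeff n (g s)).coeff m) l
      (𝓝 ((PowerSeries.coeff n g₀).coeff m))) (k n : ℕ) (m : Fin 2 × ℕ+ →₀ ℕ) :
    Tendsto (fun s => (PowerSeries.coeff n (g s ^ k)).coeff m) l
      (𝓝 ((PowerSeries.coeff n (g₀ ^ k)).coeff m)) := by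
  induction k generalizing n m with
  | zero => simpa only [pow_zero] using tendsto_const_nhds
  | succ k ih =>
    simp only [pow_succ, PowerSeries.coeff_mul]
    exact tendsto_coeff_sum _ (fun x _ => tendsto_coeff_mul (ih x.1) (hg x.2)) m

variable {α β : ι → Fin 2 × ℕ+ → ℂ} {α₀ β₀ : Fin 2 × ℕ+ → ℂ}

theorem tendsto_creationCoeff (hα : ∀ x, Tendsto (fun s => α s x) l (𝓝 (α₀ x))) (k : ℤ)
    (m : Fin 2 × ℕ+ →₀ ℕ) :
    Tendsto (fun s => (creationCoeff (α s) k).coeff m) l (𝓝 ((creationCoeff α₀ k).coeff m)) := by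
  rcases lt_or_ge k 0 with hk | hk
  · simp only [creationCoeff_of_neg _ hk]
    exact tendsto_const_nhds
  · lift k to ℕ using hk
    simp only [creationCoeff_natCast, creationSeries, pexp, PowerSeries.coeff_mk]
    refine tendsto_coeff_sum _ (fun j _ => tendsto_coeff_smul tendsto_const_nhds ?_) m
    refine tendsto_coeff_pow (fun n m => ?_) j k
    rcases Nat.eq_zero_or_pos n with rfl | h
    · simp only [coeff_zero_mixedCurrent]
      exact tendsto_const_nhds
    · lift n to ℕ+ using h
      simp only [coeff_mixedCurrent, MvPolynomial.coeff_sum, MvPolynomial.coeff_smul]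
      exact tendsto_finsetSum _ fun i _ => (hα _).smul_const _

theorem tendsto_coeff_shift (hβ : ∀ x, Tendsto (fun s => β s x) l (𝓝 (β₀ x))) (v : Fock) (b : ℕ)
    (m : Fin 2 × ℕ+ →₀ ℕ) :
    Tendsto (fun s => ((shift (β s) v).coeff b).coeff m) l (𝓝 (((shift β₀ v).coeff b).coeff m)) := by
  induction v using MvPolynomial.induction_on generalizing b m with
  | C a => simpa only [shift_C] using tendsto_const_nhds
  | add p q hp hq =>
    simp only [map_add, Polynomial.coeff_add, MvPolynomial.coeff_add]
    exact (hp b m).add (hq b m)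
  | mul_X p x hp =>
    simp only [shift_X_mul_coeff, MvPolynomial.coeff_add]
    refine (tendsto_coeff_mul (hp b) (fun _ => tendsto_const_nhds) m).add ?_
    split_ifs
    · exact tendsto_coeff_smul (hβ x) (hp _) m
    · exact tendsto_const_nhds

/-- Each matrix element is a polynomial in finitely many of the exponents. -/
theorem tendsto_vertex (hα : ∀ x, Tendsto (fun s => α s x) l (𝓝 (α₀ x)))
    (hβ : ∀ x, Tendsto (fun s => β s x) l (𝓝 (β₀ x))) (n : ℤ) (v : Fock)
    (m : Fin 2 × ℕ+ →₀ ℕ) :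
    Tendsto (fun s => (vertex (α s) (β s) n v).coeff m) l
      (𝓝 ((vertex α₀ β₀ n v).coeff m)) := by
  obtain ⟨N, hN⟩ := exists_natDegree_shift_lt v
  simp only [vertex_apply, contract_eq_sum_range _ _ _ (hN _)]
  exact tendsto_coeff_sum _
    (fun b _ => tendsto_coeff_mul (tendsto_creationCoeff hα _) (tendsto_coeff_shift hβ v b)) m

end Continuity

/-! ### Values of rational functions given by Laurent expansions. -/

section Expansion

/-- The shift operator `(S c)_k = c_{k-1}` on sequences, which is multiplication by `y` on the level of
generating functions. -/
def seqShift : Module.End ℂ (ℤ → ℂ) where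
  toFun c k := c (k - 1)
  map_add' _ _ := rfl
  map_smul' _ _ := rfl

theorem seqShift_pow_apply (j : ℕ) (c : ℤ → ℂ) (k : ℤ) : (seqShift ^ j) c k = c (k - j) := by
  induction j generalizing k with
  | zero => simp
  | succ j ih =>
    rw [pow_succ', Module.End.mul_apply]
    change (seqShift ^ j) c (k - 1) = _
    rw [ih]
    congr 1
    push_cast
    ring

theorem aeval_seqShift_apply (R : Polynomial ℂ) (c : ℤ → ℂ) (k : ℤ) :
    Polynomial.aeval seqShift R c k = R.sum fun j r => r * c (k - j) := by
  rw [Polynomial.aeval_eq_sum_range, Polynomial.sum_over_range _ (fun j => by simp),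
    LinearMap.sum_apply, Finset.sum_apply]
  refine Finset.sum_congr rfl fun j _ => ?_
  rw [LinearMap.smul_apply, Pi.smul_apply, seqShift_pow_apply, smul_eq_mul]

/-- The value at `y` of a Laurent polynomial. -/
noncomputable def laurentEval (y : ℂ) : (ℤ →₀ ℂ) →ₗ[ℂ] ℂ :=
  Finsupp.linearCombination ℂ fun k : ℤ => y ^ k

theorem laurentEval_apply (y : ℂ) (P : ℤ →₀ ℂ) : laurentEval y P = P.sum fun k a => a * y ^ k := rfl

/-- The product of a polynomial and a Laurent polynomial. -/
noncomputable def laurentMul (R : Polynomial ℂ) (P : ℤ →₀ ℂ) : ℤ →₀ ℂ :=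
  ∑ j ∈ Finset.range (R.natDegree + 1), R.coeff j • P.mapDomain fun k : ℤ => k + j

theorem laurentMul_apply (R : Polynomial ℂ) (P : ℤ →₀ ℂ) (k : ℤ) :
    laurentMul R P k = Polynomial.aeval seqShift R (fun k => P k) k := by
  rw [aeval_seqShift_apply, Polynomial.sum_over_range _ (fun j => by simp), laurentMul,
    Finsupp.finsetSum_apply]
  refine Finset.sum_congr rfl fun j _ => ?_
  rw [Finsupp.smul_apply, smul_eq_mul]
  congr 1
  conv_lhs => rw [show k = (fun k : ℤ => k + j) (k - j) by simp]
  exact Finsupp.mapDomain_apply (add_left_injective _) _ _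

theorem laurentEval_laurentMul {y : ℂ} (hy : y ≠ 0) (R : Polynomial ℂ) (P : ℤ →₀ ℂ) :
    laurentEval y (laurentMul R P) = R.eval y * laurentEval y P := by
  rw [laurentMul, map_sum, Polynomial.eval_eq_sum_range, Finset.sum_mul]
  refine Finset.sum_congr rfl fun j _ => ?_
  rw [map_smul, laurentEval, Finsupp.linearCombination_mapDomain, smul_eq_mul, mul_assoc]
  congr 1
  rw [Finsupp.linearCombination_apply, Finsupp.linearCombination_apply, Finsupp.mul_sum]
  refine Finset.sum_congr rfl fun k _ => ?_
  simp only [Function.comp, smul_eq_mul]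
  rw [zpow_add₀ hy, zpow_natCast]
  ring

theorem isExpansionValue_iff {c : ℤ → ℂ} {y x : ℂ} :
    IsExpansionValue c y x ↔ (∃ K : ℤ, ∀ k < K, c k = 0) ∧
      ∃ (R : Polynomial ℂ) (P : ℤ →₀ ℂ), R.eval y ≠ 0 ∧
        Polynomial.aeval seqShift R c = (fun k => P k) ∧ x = laurentEval y P / R.eval y := by
  simp only [IsExpansionValue, funext_iff, aeval_seqShift_apply, laurentEval_apply]

theorem aeval_seqShift_mul {c : ℤ → ℂ} {R : Polynomial ℂ} {P : ℤ →₀ ℂ}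
    (h : Polynomial.aeval seqShift R c = fun k => P k) (R' : Polynomial ℂ) :
    Polynomial.aeval seqShift (R' * R) c = fun k => laurentMul R' P k := by
  rw [map_mul, Module.End.mul_apply, h]
  exact funext fun k => (laurentMul_apply R' P k).symm

/-- Sequences form a module over polynomials in the shift. Applying both denominators in either
order to `c` gives R'P = RP', which is then evaluated at `y`. -/
theorem IsExpansionValue.unique {c : ℤ → ℂ} {y x x' : ℂ} (hy : y ≠ 0)
    (h : IsExpansionValue c y x) (h' : IsExpansionValue c y x') : x = x' := by
  obtain ⟨-, R, P, hR, hP, rfl⟩ := isExpansionValue_iff.1 h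
  obtain ⟨-, R', P', hR', hP', rfl⟩ := isExpansionValue_iff.1 h'
  have h1 : laurentMul R' P = laurentMul R P' := Finsupp.ext fun k =>
    congrFun ((aeval_seqShift_mul hP R').symm.trans
      ((mul_comm R' R ▸ aeval_seqShift_mul hP' R :))) k
  have h2 := congrArg (laurentEval y) h1
  rw [laurentEval_laurentMul hy, laurentEval_laurentMul hy] at h2
  rw [div_eq_div_iff hR hR', mul_comm _ (R'.eval y), h2, mul_comm]

theorem isExpansionValue_zero (y : ℂ) : IsExpansionValue (fun _ => 0) y 0 :=
  isExpansionValue_iff.2 ⟨⟨0, fun _ _ => rfl⟩, 1, 0, by simp, by simp, by simp⟩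

theorem IsExpansionValue.add {c c' : ℤ → ℂ} {y x x' : ℂ} (hy : y ≠ 0)
    (h : IsExpansionValue c y x) (h' : IsExpansionValue c' y x') :
    IsExpansionValue (fun k => c k + c' k) y (x + x') := by
  obtain ⟨⟨K, hK⟩, R, P, hR, hP, rfl⟩ := isExpansionValue_iff.1 h
  obtain ⟨⟨K', hK'⟩, R', P', hR', hP', rfl⟩ := isExpansionValue_iff.1 h'
  refine isExpansionValue_iff.2 ⟨⟨min K K', fun k hk => ?_⟩, R * R',
    laurentMul R' P + laurentMul R P', ?_, ?_, ?_⟩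
  · rw [hK k (lt_min_iff.1 hk).1, hK' k (lt_min_iff.1 hk).2, add_zero]
  · rw [Polynomial.eval_mul]
    exact mul_ne_zero hR hR'
  · have h1 := aeval_seqShift_mul hP R'
    rw [mul_comm] at h1
    change Polynomial.aeval seqShift (R * R') (c + c') = _
    rw [map_add, h1, aeval_seqShift_mul hP' R]
    rfl
  · rw [map_add, laurentEval_laurentMul hy, laurentEval_laurentMul hy, Polynomial.eval_mul,
      div_add_div _ _ hR hR']
    congr 1
    ring

theorem IsExpansionValue.const_mul {c : ℤ → ℂ} {y x : ℂ} (h : IsExpansionValue c y x) (a : ℂ) :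
    IsExpansionValue (fun k => a * c k) y (a * x) := by
  obtain ⟨⟨K, hK⟩, R, P, hR, hP, rfl⟩ := isExpansionValue_iff.1 h
  refine isExpansionValue_iff.2 ⟨⟨K, fun k hk => by rw [hK k hk, mul_zero]⟩, R, a • P, hR, ?_, ?_⟩
  · change Polynomial.aeval seqShift R (a • c) = _
    rw [map_smul, hP]
    rfl
  · rw [map_smul, smul_eq_mul, mul_div_assoc]

theorem IsExpansionValue.sum {ι : Type*} {y : ℂ} (hy : y ≠ 0) (S : Finset ι) {c : ι → ℤ → ℂ}
    {x : ι → ℂ} (h : ∀ i ∈ S, IsExpansionValue (c i) y (x i)) :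
    IsExpansionValue (fun k => ∑ i ∈ S, c i k) y (∑ i ∈ S, x i) := by
  classical
  induction S using Finset.induction_on with
  | empty => simpa using isExpansionValue_zero y
  | insert i S hi ih =>
    simp only [Finset.sum_insert hi]
    exact (h i (Finset.mem_insert_self i S)).add hy
      (ih fun j hj => h j (Finset.mem_insert_of_mem hj))

/-- The coefficients of a power series, extended by zero to negative indices. -/
noncomputable def intCoeff (f : PowerSeries ℂ) (k : ℤ) : ℂ :=
  if 0 ≤ k then PowerSeries.coeff k.toNat f else 0

theorem intCoeff_natCast (f : PowerSeries ℂ) (n : ℕ) :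
    intCoeff f n = PowerSeries.coeff n f := by simp [intCoeff]

theorem intCoeff_of_neg (f : PowerSeries ℂ) {k : ℤ} (hk : k < 0) : intCoeff f k = 0 := by
  simp [intCoeff, hk]

theorem aeval_seqShift_intCoeff (R : Polynomial ℂ) (f : PowerSeries ℂ) :
    Polynomial.aeval seqShift R (intCoeff f) = intCoeff ((R : PowerSeries ℂ) * f) := by
  ext k
  rw [aeval_seqShift_apply]
  rcases lt_or_ge k 0 with hk | hk
  · rw [intCoeff_of_neg _ hk, Polynomial.sum_def, Finset.sum_eq_zero]
    intro j _
    rw [intCoeff_of_neg _ (by omega), mul_zero]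
  · lift k to ℕ using hk
    rw [intCoeff_natCast, PowerSeries.coeff_mul,
      Finset.Nat.sum_antidiagonal_eq_sum_range_succ_mk,
      Polynomial.sum_over_range' _ (fun j => by simp) (R.natDegree + 1 + (k + 1)) (by omega)]
    symm
    rw [← Finset.sum_subset (Finset.range_mono (show k + 1 ≤ R.natDegree + 1 + (k + 1) by omega))]
    · refine Finset.sum_congr rfl fun j hj => ?_
      have hj : j ≤ k := by simpa [Nat.lt_succ_iff] using hj
      rw [Polynomial.coeff_coe, show (k : ℤ) - j = (k - j : ℕ) by omega, intCoeff_natCast]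
    · intro j _ hj
      rw [intCoeff_of_neg _ (by simp at hj; omega), mul_zero]

theorem isExpansionValue_intCoeff {f : PowerSeries ℂ} {R Q : Polynomial ℂ}
    (h : (R : PowerSeries ℂ) * f = Q) {y : ℂ} (hR : R.eval y ≠ 0) :
    IsExpansionValue (intCoeff f) y (Q.eval y / R.eval y) := by
  refine isExpansionValue_iff.2 ⟨⟨0, fun k hk => intCoeff_of_neg f hk⟩, R,
    Q.sum fun j r => Finsupp.single (j : ℤ) r, hR, ?_, ?_⟩
  · rw [aeval_seqShift_intCoeff, h]
    ext k
    rw [Polynomial.sum_def, Finsupp.finsetSum_apply]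
    rcases lt_or_ge k 0 with hk | hk
    · rw [intCoeff_of_neg _ hk, Finset.sum_eq_zero]
      intro j _
      rw [Finsupp.single_apply, if_neg (by omega)]
    · lift k to ℕ using hk
      rw [intCoeff_natCast, Polynomial.coeff_coe]
      simp [Finsupp.single_apply]
  · congr 1
    rw [Polynomial.sum_def, map_sum, Polynomial.eval_eq_sum, Polynomial.sum_def]
    refine Finset.sum_congr rfl fun j _ => ?_
    simp [laurentEval]

theorem IsExpansionValue.shift {c : ℤ → ℂ} {y x : ℂ} (hy : y ≠ 0) (h : IsExpansionValue c y x)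
    (l : ℤ) : IsExpansionValue (fun k => c (k - l)) y (x * y ^ l) := by
  obtain ⟨⟨K, hK⟩, R, P, hR, hP, rfl⟩ := isExpansionValue_iff.1 h
  refine isExpansionValue_iff.2 ⟨⟨K + l, fun k hk => hK _ (by omega)⟩, R,
    P.mapDomain fun k => k + l, hR, ?_, ?_⟩
  · ext k
    have h1 := congrFun hP (k - l)
    rw [aeval_seqShift_apply] at h1 ⊢
    conv_rhs => rw [show k = (fun k : ℤ => k + l) (k - l) by simp]
    rw [Finsupp.mapDomain_apply (add_left_injective _), ← h1]
    simp only [sub_right_comm]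
  · rw [div_mul_eq_mul_div]
    congr 1
    rw [laurentEval, Finsupp.linearCombination_mapDomain, Finsupp.linearCombination_apply,
      Finsupp.linearCombination_apply, Finsupp.sum_mul]
    refine Finset.sum_congr rfl fun k _ => ?_
    simp only [Function.comp, smul_eq_mul]
    rw [zpow_add₀ hy, mul_assoc]

/-- The value of the product of a rational power series and a Laurent polynomial. -/
theorem isExpansionValue_convolution {f : PowerSeries ℂ} {R Q : Polynomial ℂ}
    (h : (R : PowerSeries ℂ) * f = Q) {y : ℂ} (hy : y ≠ 0) (hR : R.eval y ≠ 0) (N : ℤ →₀ ℂ)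
    {c : ℤ → ℂ} {M : ℤ → ℕ} (hM : ∀ k l, N l ≠ 0 → k - l < M k)
    (hc : ∀ k, c k = ∑ j ∈ Finset.range (M k), PowerSeries.coeff j f * N (k - j)) :
    IsExpansionValue c y (Q.eval y / R.eval y * laurentEval y N) := by
  -- The convolution is regrouped as a finite combination of shifts of the expansion of `f`, one for
  -- each exponent of `N`.
  have h1 : c = fun k => ∑ l ∈ N.support, N l * intCoeff f (k - l) := by
    ext k
    have h2 : ∀ l ∈ N.support, N l * intCoeff f (k - l) =
        ∑ j ∈ Finset.range (M k), if l = k - j then PowerSeries.coeff j f * N (k - j) else 0 := by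
      intro l hl
      have h3 := hM k l (Finsupp.mem_support_iff.1 hl)
      rcases lt_or_ge (k - l) 0 with h4 | h4
      · rw [intCoeff_of_neg _ h4, mul_zero, Finset.sum_eq_zero]
        intro j _
        rw [if_neg (by omega)]
      · rw [Finset.sum_eq_single_of_mem (k - l).toNat (by rw [Finset.mem_range]; omega)]
        · rw [if_pos (by omega), intCoeff, if_pos h4, Int.toNat_of_nonneg h4, mul_comm,
            sub_sub_cancel]
        · intro j _ hj
          rw [if_neg (by omega)]
    rw [hc, Finset.sum_congr rfl h2, Finset.sum_comm]
    refine Finset.sum_congr rfl fun j _ => ?_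
    rw [Finset.sum_ite_eq']
    split_ifs with h5
    · rfl
    · rw [Finsupp.notMem_support_iff.1 h5, mul_zero]
  rw [h1, laurentEval_apply, Finsupp.mul_sum]
  refine IsExpansionValue.sum hy _ fun l _ => ?_
  have := ((isExpansionValue_intCoeff h hR).shift hy l).const_mul (N l)
  rwa [mul_left_comm] at this

end Expansion

/-! ### Products of two vertex operators as rational functions. -/

section VertexProduct

/-- This is the Cauchy product of two creation series, one of them in the variable z/y. -/
theorem sum_creationCoeff_mul (α α' : Fin 2 × ℕ+ → ℂ) {y : ℂ} (hy : y ≠ 0) (a b : ℤ) :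
    ∑ k ∈ Finset.Icc (-a) b, y ^ k • (creationCoeff α' (a + k) * creationCoeff α (b - k)) =
      y ^ b • creationCoeff ((fun x => y⁻¹ ^ (x.2 : ℕ) * α x) + α') (a + b) := by
  rcases lt_or_ge (a + b) 0 with h | h
  · rw [creationCoeff_of_neg _ h, smul_zero, Finset.Icc_eq_empty (by omega), Finset.sum_empty]
  · obtain ⟨d, hd⟩ := Int.eq_ofNat_of_zero_le h
    rw [hd, creationCoeff_natCast, creationSeries_add, PowerSeries.coeff_mul, Finset.smul_sum]
    refine Finset.sum_bij' (fun k _ => ((b - k).toNat, (a + k).toNat)) (fun x _ => b - x.1) ?_ ?_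
      ?_ ?_ ?_
    · intro k hk
      rw [Finset.mem_Icc] at hk
      rw [Finset.HasAntidiagonal.mem_antidiagonal]
      simp only
      omega
    · intro x hx
      rw [Finset.HasAntidiagonal.mem_antidiagonal] at hx
      rw [Finset.mem_Icc]
      omega
    · intro k hk
      rw [Finset.mem_Icc] at hk
      simp only
      omega
    · intro x hx
      rw [Finset.HasAntidiagonal.mem_antidiagonal] at hx
      ext <;> simp only <;> omega
    · intro k hk
      rw [Finset.mem_Icc] at hk
      simp only
      rw [← creationCoeff_natCast, ← creationCoeff_natCast, creationCoeff_scale,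
        Int.toNat_natCast, Int.toNat_of_nonneg (by omega), Int.toNat_of_nonneg (by omega),
        smul_mul_assoc, smul_smul, mul_comm (creationCoeff α _)]
      congr 1
      rw [inv_pow, ← zpow_natCast, Int.toNat_of_nonneg (by omega), ← zpow_neg, ← zpow_add₀ hy]
      congr 1
      ring

theorem shift_add_apply (β β' : Fin 2 × ℕ+ → ℂ) (v : Fock) :
    shift (β + β') v =
      (shift β' v).sum fun b f => shift β f * Polynomial.X ^ b := by
  have h : (shift (β + β') : Fock →+* Polynomial Fock) =
      (Polynomial.eval₂RingHom (shift β : Fock →+* Polynomial Fock) Polynomial.X).comp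
        (shift β' : Fock →+* Polynomial Fock) := by
    refine MvPolynomial.ringHom_ext (fun a => ?_) fun x => ?_
    · simp
    · simp [shift_X, Polynomial.eval₂_monomial, Polynomial.C_mul_X_pow_eq_monomial,
        add_assoc]
  exact (congrArg (fun φ : Fock →+* Polynomial Fock => φ v) h).trans Polynomial.eval₂_eq_sum

/-- Normal ordering costs the exchange factor in z/w. In a fixed matrix element the normally ordered
product is a Laurent polynomial in z/w, whose value at `y` merges the two vertex operators into one
with w = z/y. -/
theorem isExpansionValue_vertex_mul (α β α' β' : Fin 2 × ℕ+ → ℂ) {y : ℂ} (hy : y ≠ 0)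
    {R Q : Polynomial ℂ} (h : (R : PowerSeries ℂ) * exchangeFactor β α' = Q) (hR : R.eval y ≠ 0)
    (n : ℤ) (v : Fock) (m : Fin 2 × ℕ+ →₀ ℕ) :
    IsExpansionValue (fun k => (vertex α β k (vertex α' β' (n - k) v)).coeff m) y
      (Q.eval y / R.eval y *
        (vertex ((fun x => y⁻¹ ^ (x.2 : ℕ) * α x) + α')
          ((fun x => y ^ (x.2 : ℕ) * β x) + β') n v).coeff m) := by
  obtain ⟨N, hN⟩ := exists_natDegree_shift_lt v
  choose N₂ hN₂ using exists_natDegree_shift_lt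
  set c : ℕ → Fock := (shift β' v).coeff with hc
  set α'' := (fun x : Fin 2 × ℕ+ => y⁻¹ ^ (x.2 : ℕ) * α x) + α' with hα''
  have hvalue : vertex α'' ((fun x => y ^ (x.2 : ℕ) * β x) + β') n v =
      ∑ b ∈ Finset.range N, ∑ d ∈ Finset.range (N₂ (c b)),
        (y ^ (d : ℤ) • creationCoeff α'' ((b - n) + d)) * (shift β (c b)).coeff d := by
    rw [vertex_apply, shift_add_apply, Polynomial.sum_over_range' _ (fun b => by simp) _ (hN β'),
      map_sum]
    refine Finset.sum_congr rfl fun b _ => ?_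
    rw [contract_mul_X_pow, contract_eq_sum_range _ _ _ (hN₂ _ _)]
    refine Finset.sum_congr rfl fun d _ => ?_
    rw [coeff_shift_scale, mul_smul_comm, smul_mul_assoc, zpow_natCast]
    congr 3
    ring
  -- The normally ordered contribution in which the inner and outer annihilation parts have orders
  -- `b` and `d`; it vanishes unless n - b ≤ k ≤ d.
  let G : ℕ → ℕ → ℤ → ℂ := fun b d k =>
    (creationCoeff α' ((b - n) + k) * (creationCoeff α (d - k) * (shift β (c b)).coeff d)).coeff m
  have hG : ∀ b d k, G b d k ≠ 0 → k ∈ Finset.Icc (-((b : ℤ) - n)) d := by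
    intro b d k hk
    rw [Finset.mem_Icc]
    by_contra h1
    apply hk
    rcases lt_or_ge k (-((b : ℤ) - n)) with h2 | h2
    · simp [G, creationCoeff_of_neg α' (show (b : ℤ) - n + k < 0 by omega)]
    · simp [G, creationCoeff_of_neg α (show (d : ℤ) - k < 0 by omega)]
  let NF : ℕ → ℕ → ℤ →₀ ℂ := fun b d => Finsupp.onFinset _ (G b d) (hG b d)
  have hNF : ∀ b d, laurentEval y (NF b d) =
      ((y ^ (d : ℤ) • creationCoeff α'' ((b - n) + d)) * (shift β (c b)).coeff d).coeff m := by
    intro b d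
    rw [← sum_creationCoeff_mul α α' hy, laurentEval_apply,
      Finsupp.onFinset_sum _ (fun k => by simp), Finset.sum_mul, MvPolynomial.coeff_sum]
    refine Finset.sum_congr rfl fun k _ => ?_
    rw [smul_mul_assoc, MvPolynomial.coeff_smul, smul_eq_mul, mul_assoc, mul_comm]
  rw [hvalue]
  simp only [MvPolynomial.coeff_sum, Finset.mul_sum, ← hNF]
  have hexp : ∀ k, (vertex α β k (vertex α' β' (n - k) v)).coeff m =
      ∑ b ∈ Finset.range N, ∑ d ∈ Finset.range (N₂ (c b)),
        ∑ j ∈ Finset.range ((b - n + k).toNat + 1),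
          PowerSeries.coeff j (exchangeFactor β α') * NF b d (k - j) := by
    intro k
    rw [vertex_apply α', contract_eq_sum_range _ _ _ (hN β'), map_sum, MvPolynomial.coeff_sum]
    refine Finset.sum_congr rfl fun b _ => ?_
    rw [vertex_creationCoeff_mul α β α' k
      (show (b : ℤ) - (n - k) < ((b - n + k).toNat + 1 : ℕ) by omega), MvPolynomial.coeff_sum,
      Finset.sum_comm]
    refine Finset.sum_congr rfl fun j _ => ?_
    rw [MvPolynomial.coeff_smul, smul_eq_mul, vertex_apply, contract_eq_sum_range _ _ _ (hN₂ _ _),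
      Finset.mul_sum, MvPolynomial.coeff_sum, Finset.mul_sum]
    refine Finset.sum_congr rfl fun d _ => ?_
    simp only [NF, Finsupp.onFinset_apply, G]
    congr 5
    ring
  simp only [hexp]
  refine IsExpansionValue.sum hy _ fun b _ => IsExpansionValue.sum hy _ fun d _ => ?_
  refine isExpansionValue_convolution h hy hR (NF b d)
    (M := fun k => (b - n + k).toNat + 1) (fun k l hl => ?_) fun k => rfl
  have := Finset.mem_Icc.1 (hG b d l hl)
  omega

end VertexProduct

/-! ### Exchange factors given by power sums. -/

section RationalFactor

/-- The polynomial `1 - a x`. -/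
noncomputable def oneSubMul (a : ℂ) : Polynomial ℂ := 1 - Polynomial.C a * Polynomial.X

theorem eval_oneSubMul (a y : ℂ) : (oneSubMul a).eval y = 1 - a * y := by simp [oneSubMul]

/-- The series `log (1 - a x) = - ∑_{n ≥ 1} a^n x^n / n`. -/
noncomputable def logOneSub (a : ℂ) : PowerSeries ℂ := PowerSeries.mk fun n => -(a ^ n / n)

theorem pexp_list_sum (L : List ℂ) :
    PowerSeries.coeff 0 (L.map logOneSub).sum = 0 ∧
    pexp (L.map logOneSub).sum =
      ((L.map oneSubMul).prod : Polynomial ℂ) := by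
  induction L with
  | nil => simp [pexp_zero]
  | cons a L ih =>
    have h0 : PowerSeries.coeff 0 (logOneSub a) = 0 := by simp [logOneSub]
    simp only [List.map_cons, List.sum_cons, List.prod_cons]
    refine ⟨by rw [map_add, h0, ih.1, add_zero], ?_⟩
    rw [pexp_add h0 ih.1, ih.2, logOneSub, pexp_neg_geometric, Polynomial.coe_mul, oneSubMul,
      Polynomial.coe_sub, Polynomial.coe_mul, Polynomial.coe_one, Polynomial.coe_C,
      Polynomial.coe_X]

theorem coeff_list_sum (L : List ℂ) (n : ℕ) :
    PowerSeries.coeff n (L.map logOneSub).sum =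
      -((L.map fun a => a ^ n).sum / n) := by
  induction L with
  | nil => simp
  | cons a L ih =>
    simp only [List.map_cons, List.sum_cons, map_add, ih, logOneSub, PowerSeries.coeff_mk]
    ring

/-- Power sums divided by n are, up to sign, the coefficients of logarithms of linear factors; `L`
lists the denominator and `L'` the numerator. -/
theorem mul_exchangeFactor_eq {β α : Fin 2 × ℕ+ → ℂ} (L L' : List ℂ)
    (h : ∀ n : ℕ+, ∑ i, β (i, n) * α (i, n) =
      ((L.map fun a => a ^ (n : ℕ)).sum - (L'.map fun a => a ^ (n : ℕ)).sum) / (n : ℕ)) :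
    ((L.map oneSubMul).prod : Polynomial ℂ) * exchangeFactor β α =
      ((L'.map oneSubMul).prod : Polynomial ℂ) := by
  rw [← (pexp_list_sum L').2, ← (pexp_list_sum L).2, exchangeFactor,
    ← pexp_add (pexp_list_sum L).1 (coeff_zero_mixedCurrent _ _)]
  congr 1
  refine ext_mixedCurrent ?_ fun n => ?_
  · rw [map_add, (pexp_list_sum L).1, (pexp_list_sum L').1, coeff_zero_mixedCurrent, add_zero]
  · have h1 : PowerSeries.coeff n (mixedCurrent (β * α) (1 : Fin 2 × ℕ+ → ℂ)) =
        ∑ i, β (i, n) * α (i, n) := by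
      rw [coeff_mixedCurrent]; simp
    rw [map_add, h1, h n, coeff_list_sum, coeff_list_sum]
    ring

end RationalFactor

/-! ### Fusion of the two currents and the crystal limit. -/

section Limits
variable (t : ℂ)

/-- The coefficient `(1 - t^{-n}) / n`. -/
noncomputable def cN (n : ℕ+) : ℂ := (1 - (t ^ (n : ℕ))⁻¹) / (n : ℕ)

/-- Creation exponents of `Λ¹`. -/
noncomputable def lamOneC (s : ℂ) (x : Fin 2 × ℕ+) : ℂ := ![cN t x.2 * s ^ (x.2 : ℕ), 0] x.1

/-- Annihilation exponents of `Λ¹`. -/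
noncomputable def lamOneA (s : ℂ) (x : Fin 2 × ℕ+) : ℂ :=
  ![-(1 - (t * s ^ 2) ^ (x.2 : ℕ)) * (s ^ (x.2 : ℕ))⁻¹, 0] x.1

/-- Creation exponents of `Λ²`. -/
noncomputable def lamTwoC (s : ℂ) (x : Fin 2 × ℕ+) : ℂ :=
  ![cN t x.2 * (1 - ((s ^ 2) ^ (x.2 : ℕ))⁻¹) * s ^ (x.2 : ℕ), cN t x.2 * s⁻¹ ^ (x.2 : ℕ)] x.1

/-- Annihilation exponents of `Λ²`. -/
noncomputable def lamTwoA (s : ℂ) (x : Fin 2 × ℕ+) : ℂ :=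
  ![0, -(1 - (t * s ^ 2) ^ (x.2 : ℕ)) * s ^ (x.2 : ℕ)] x.1

variable {t}

theorem etaCreation_eq (i : Fin 2) (c : ℂ) :
    etaCreation t i c = PowerSeries.map (Algebra.lmul ℂ Fock : Fock →+* Op)
      (creationSeries fun x => if x.1 = i then cN t x.2 * c ^ (x.2 : ℕ) else 0) := by
  rw [etaCreation, current_eq_mixedCurrent _ i (fun x => creation x.1 x.2), expSeries_creation]
  rfl

theorem phi_eq (p : ℂ) (i : Fin 2) (c : ℂ) :
    phi t p i c = PowerSeries.map (Algebra.lmul ℂ Fock : Fock →+* Op)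
      (creationSeries fun x =>
        if x.1 = i then cN t x.2 * (1 - (p ^ (x.2 : ℕ))⁻¹) * c ^ (x.2 : ℕ) else 0) := by
  rw [phi, current_eq_mixedCurrent _ i (fun x => creation x.1 x.2), expSeries_creation]
  rfl

/-- The normalization n(1 - q^n)/(1 - t^n) of the bosons cancels the coefficient (1 - t^n)/n, which
requires t^n ≠ 1. -/
theorem etaAnnihilation_eq (ht : ∀ n : ℕ, 0 < n → t ^ n ≠ 1) (q : ℂ) (i : Fin 2) (c : ℂ) :
    etaAnnihilation t q i c = annihilationSeries fun x =>
      if x.1 = i then -(1 - q ^ (x.2 : ℕ)) * (c ^ (x.2 : ℕ))⁻¹ else 0 := by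
  rw [etaAnnihilation, expSeries_eq_pexp, annihilationSeries,
    current_eq_mixedCurrent _ i (fun x => annihilation t q x.1 x.2)]
  congr 1
  refine ext_mixedCurrent (by simp [mixedCurrent]) fun n => ?_
  rw [coeff_mixedCurrent, coeff_mixedCurrent]
  refine Finset.sum_congr rfl fun j _ => ?_
  simp only [annihilation, smul_smul]
  congr 1
  split_ifs
  · have h1 : 1 - t ^ (n : ℕ) ≠ 0 := sub_ne_zero.2 (ht n n.pos).symm
    have h2 : ((n : ℕ) : ℂ) ≠ 0 := Nat.cast_ne_zero.2 n.ne_zero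
    field_simp
  · rw [zero_mul]

theorem X1_eq (ht : ∀ n : ℕ, 0 < n → t ^ n ≠ 1) (u : Fin 2 → ℂ) (s : ℂ) (n : ℤ) (v : Fock) :
    X1 t u s n v = u 0 • vertex (lamOneC t s) (lamOneA t s) n v +
      u 1 • vertex (lamTwoC t s) (lamTwoA t s) n v := by
  rw [X1]
  congr 2
  · refine mode_eq_vertex ?_ ?_ n v
    · rw [etaCreation_eq]
      refine congrArg (fun α => PowerSeries.map _ (creationSeries α)) (funext fun ⟨i, n⟩ => ?_)
      fin_cases i <;> simp [lamOneC]
    · rw [etaAnnihilation_eq ht]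
      congr 1
      ext ⟨i, n⟩
      fin_cases i <;> simp [lamOneA]
  · refine mode_eq_vertex ?_ ?_ n v
    · rw [etaCreation_eq, phi_eq, ← map_mul, ← creationSeries_add]
      refine congrArg (fun α => PowerSeries.map _ (creationSeries α)) (funext fun ⟨i, n⟩ => ?_)
      fin_cases i <;> simp [lamTwoC]
    · rw [etaAnnihilation_eq ht]
      congr 1
      ext ⟨i, n⟩
      fin_cases i <;> simp [lamTwoA]

/-- Of the four products only Λ²Λ¹ survives: the other three exchange factors contain 1 - p y in the
numerator and are evaluated at y = p⁻¹. The conditions on `s` keep the denominators nonzero. -/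
theorem isX2Coeff (ht0 : t ≠ 0) (ht : ∀ n : ℕ, 0 < n → t ^ n ≠ 1) (u : Fin 2 → ℂ) {s : ℂ}
    (hs : s ≠ 0) (hq : t * s ^ 2 ≠ 1) (hp : s ^ 4 ≠ 1) (n : ℤ) (v : Fock)
    (m : Fin 2 × ℕ+ →₀ ℕ) :
    IsX2Coeff t u s n v m (u 1 * u 0 *
      (vertex ((fun x => ((s ^ 2)⁻¹)⁻¹ ^ (x.2 : ℕ) * lamTwoC t s x) + lamOneC t s)
        ((fun x => (s ^ 2)⁻¹ ^ (x.2 : ℕ) * lamTwoA t s x) + lamOneA t s) n v).coeff m) := by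
  have hy : (s ^ 2)⁻¹ ≠ 0 := inv_ne_zero (pow_ne_zero 2 hs)
  have ht1 : t ≠ 1 := by simpa using ht 1 one_pos
  have hn : ∀ n : ℕ+, ((n : ℕ) : ℂ) ≠ 0 := fun n => Nat.cast_ne_zero.2 n.ne_zero
  have h11 := mul_exchangeFactor_eq (β := lamOneA t s) (α := lamOneC t s) [t⁻¹, t * s ^ 2]
    [1, s ^ 2] fun n => by
      have := hn n
      simp [lamOneA, lamOneC, cN]
      field_simp
      ring
  have h22 := mul_exchangeFactor_eq (β := lamTwoA t s) (α := lamTwoC t s) [t⁻¹, t * s ^ 2]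
    [1, s ^ 2] fun n => by
      have := hn n
      simp [lamTwoA, lamTwoC, cN]
      field_simp
      ring
  -- Expand -(1 - q^n)(1 - t^{-n})(1 - p^{-n}) with q = tp; the two constant terms cancel.
  have h12 := mul_exchangeFactor_eq (β := lamOneA t s) (α := lamTwoC t s)
    [t⁻¹, t * s ^ 2, (s ^ 2)⁻¹] [s ^ 2, t, (t * s ^ 2)⁻¹] fun n => by
      have := hn n
      simp [lamOneA, lamTwoC, cN, mul_pow]
      field_simp
      ring
  have h21 := mul_exchangeFactor_eq (β := lamTwoA t s) (α := lamOneC t s) [] [] fun n => by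
      simp [lamTwoA, lamOneC]
  have e1 : 1 - t⁻¹ * (s ^ 2)⁻¹ ≠ 0 := by
    rw [← mul_inv, sub_ne_zero]
    exact fun h => hq (by rw [← inv_inv (t * s ^ 2), ← h, inv_one])
  have e2 : 1 - t * s ^ 2 * (s ^ 2)⁻¹ ≠ 0 := by
    rw [mul_assoc, mul_inv_cancel₀ (pow_ne_zero 2 hs), mul_one]
    exact sub_ne_zero.2 ht1.symm
  have e3 : 1 - (s ^ 2)⁻¹ * (s ^ 2)⁻¹ ≠ 0 := by
    rw [← mul_inv, sub_ne_zero, ← pow_add]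
    exact fun h => hp (by rw [← inv_inv (s ^ 4), ← h, inv_one])
  -- This is the common zero of the numerators of `h11`, `h22` and `h12`.
  have e0 : 1 - s ^ 2 * (s ^ 2)⁻¹ = 0 := by
    rw [mul_inv_cancel₀ (pow_ne_zero 2 hs), sub_self]
  have r11 := (isExpansionValue_vertex_mul (lamOneC t s) (lamOneA t s) (lamOneC t s) (lamOneA t s)
    hy h11 (by simp [eval_oneSubMul, e1, e2]) n v m).const_mul (u 0 * u 0)
  have r22 := (isExpansionValue_vertex_mul (lamTwoC t s) (lamTwoA t s) (lamTwoC t s) (lamTwoA t s)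
    hy h22 (by simp [eval_oneSubMul, e1, e2]) n v m).const_mul (u 1 * u 1)
  have r12 := (isExpansionValue_vertex_mul (lamOneC t s) (lamOneA t s) (lamTwoC t s) (lamTwoA t s)
    hy h12 (by simp [eval_oneSubMul, e1, e2, e3]) n v m).const_mul (u 0 * u 1)
  have r21 := (isExpansionValue_vertex_mul (lamTwoC t s) (lamTwoA t s) (lamOneC t s) (lamOneA t s)
    hy h21 (by simp) n v m).const_mul (u 1 * u 0)
  have r := ((r11.add hy r12).add hy r22).add hy r21
  rw [IsX2Coeff]
  simp only [List.map_cons, List.map_nil, List.prod_cons, List.prod_nil, Polynomial.eval_mul,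
    Polynomial.eval_one, eval_oneSubMul, e0, mul_zero, zero_mul, zero_div, zero_add, div_one,
    one_mul] at r
  refine (congrArg (fun c => IsExpansionValue c _ _) (funext fun k => ?_)).mpr r
  simp only [X1_eq ht, map_add, map_smul, smul_add, MvPolynomial.coeff_add,
    MvPolynomial.coeff_smul, smul_eq_mul]
  ring

/-- The exponents of the crystallized operators. -/
noncomputable def crysOneC (t : ℂ) (x : Fin 2 × ℕ+) : ℂ := ![cN t x.2, 0] x.1
/-- Annihilation exponents of the limit of `Λ¹`. -/
noncomputable def crysOneA (x : Fin 2 × ℕ+) : ℂ := ![-1, 0] x.1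
/-- Creation exponents of the limit of `Λ²`. -/
noncomputable def crysTwoC (t : ℂ) (x : Fin 2 × ℕ+) : ℂ := ![-cN t x.2, cN t x.2] x.1
/-- Annihilation exponents of the limit of `Λ²`. -/
noncomputable def crysTwoA (x : Fin 2 × ℕ+) : ℂ := ![0, -1] x.1
/-- Creation exponents of the limit of `X^{(2)}`. -/
noncomputable def crysThreeC (t : ℂ) (x : Fin 2 × ℕ+) : ℂ := ![0, cN t x.2] x.1
/-- Annihilation exponents of the limit of `X^{(2)}`. -/
noncomputable def crysThreeA (_ : Fin 2 × ℕ+) : ℂ := -1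

/-- The crystallized operator `X̃^{(1)}_n`. -/
noncomputable def crysX1 (t : ℂ) (u : Fin 2 → ℂ) (n : ℤ) : Op :=
  (u 0 * if 0 ≤ n then 1 else 0) • vertex (crysOneC t) crysOneA n +
    (u 1 * if n ≤ 0 then 1 else 0) • vertex (crysTwoC t) crysTwoA n

/-- The crystallized operator `X̃^{(2)}_n`. -/
noncomputable def crysX2 (t : ℂ) (u : Fin 2 → ℂ) (n : ℤ) : Op :=
  (u 1 * u 0) • vertex (crysThreeC t) crysThreeA n

/-- For n < 0 the product is s^{2|n|}. This is how the normalization p^{|n|/2} discards Λ¹ in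
negative modes. -/
theorem tendsto_pow_natAbs_mul_zpow_neg (n : ℤ) :
    Tendsto (fun s : ℂ => s ^ n.natAbs * s ^ (-n)) (𝓝[≠] 0) (𝓝 (if 0 ≤ n then 1 else 0)) := by
  split_ifs with h
  · refine tendsto_const_nhds.congr' ?_
    filter_upwards [self_mem_nhdsWithin] with s hs
    rw [← zpow_natCast, Int.natAbs_of_nonneg h, ← zpow_add₀ hs, add_neg_cancel, zpow_zero]
  · obtain ⟨k, rfl⟩ : ∃ k : ℕ, n = -((k + 1 : ℕ) : ℤ) := ⟨n.natAbs - 1, by omega⟩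
    have h1 : Tendsto (fun s : ℂ => s ^ (k + 1) * s ^ (k + 1)) (𝓝[≠] 0) (𝓝 0) := by
      have : Continuous fun s : ℂ => s ^ (k + 1) * s ^ (k + 1) := by fun_prop
      simpa using (this.tendsto 0).mono_left nhdsWithin_le_nhds
    refine h1.congr fun s => ?_
    rw [Int.natAbs_neg, Int.natAbs_natCast, neg_neg, zpow_natCast]

theorem tendsto_pow_natAbs_mul_zpow (n : ℤ) :
    Tendsto (fun s : ℂ => s ^ n.natAbs * s ^ n) (𝓝[≠] 0) (𝓝 (if n ≤ 0 then 1 else 0)) := by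
  have := tendsto_pow_natAbs_mul_zpow_neg (-n)
  simpa only [Int.natAbs_neg, neg_neg, Left.nonneg_neg_iff] using this

theorem vertex_lamOne {s : ℂ} (hs : s ≠ 0) (n : ℤ) (v : Fock) :
    vertex (lamOneC t s) (lamOneA t s) n v = s ^ (-n) •
      vertex (crysOneC t) (fun x => ![-(1 - (t * s ^ 2) ^ (x.2 : ℕ)), 0] x.1) n v := by
  rw [← vertex_scale _ _ hs]
  congr 3
  · ext ⟨i, k⟩
    fin_cases i <;> simp [lamOneC, crysOneC, mul_comm]
  · ext ⟨i, k⟩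
    fin_cases i <;> simp [lamOneA, mul_comm]

theorem vertex_lamTwo {s : ℂ} (hs : s ≠ 0) (n : ℤ) (v : Fock) :
    vertex (lamTwoC t s) (lamTwoA t s) n v = s ^ n •
      vertex (fun x => ![cN t x.2 * ((s ^ 2) ^ (x.2 : ℕ) - 1), cN t x.2] x.1)
        (fun x => ![0, -(1 - (t * s ^ 2) ^ (x.2 : ℕ))] x.1) n v := by
  have h := vertex_scale (fun x => ![cN t x.2 * ((s ^ 2) ^ (x.2 : ℕ) - 1), cN t x.2] x.1)
        (fun x => ![0, -(1 - (t * s ^ 2) ^ (x.2 : ℕ))] x.1) (inv_ne_zero hs) n v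
  rw [inv_zpow', neg_neg] at h
  rw [← h]
  congr 3
  · ext ⟨i, k⟩
    fin_cases i
    · simp [lamTwoC, ← pow_mul, mul_comm 2]
      field_simp
      ring
    · simp [lamTwoC, mul_comm]
  · ext ⟨i, k⟩
    fin_cases i <;> simp [lamTwoA, mul_comm]

/-- In the first family p^n(1 - p^{-n}) from φ and 1 from η add up to p^n, which tends to zero; in
the second family, and in the annihilation parts, all powers of p are absorbed by the rescaling. -/
theorem vertex_lamTwoOne {s : ℂ} (hs : s ≠ 0) (n : ℤ) (v : Fock) :
    vertex ((fun x => ((s ^ 2)⁻¹)⁻¹ ^ (x.2 : ℕ) * lamTwoC t s x) + lamOneC t s)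
        ((fun x => (s ^ 2)⁻¹ ^ (x.2 : ℕ) * lamTwoA t s x) + lamOneA t s) n v =
      s ^ (-n) • vertex (fun x => ![cN t x.2 * (s ^ 2) ^ (x.2 : ℕ), cN t x.2] x.1)
        (fun x => -(1 - (t * s ^ 2) ^ (x.2 : ℕ))) n v := by
  rw [← vertex_scale _ _ hs]
  congr 3
  · ext ⟨i, k⟩
    fin_cases i
    · simp [lamTwoC, lamOneC]
      field_simp
      ring
    · simp [lamTwoC, lamOneC]
      field_simp
      ring
  · ext ⟨i, k⟩
    fin_cases i
    · simp [lamTwoA, lamOneA, mul_comm]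
    · simp [lamTwoA, lamOneA]
      field_simp
      ring

theorem tendsto_pow_sq (c : ℂ) (n : ℕ+) :
    Tendsto (fun s : ℂ => (c * s ^ 2) ^ (n : ℕ)) (𝓝[≠] 0) (𝓝 0) := by
  have : Continuous fun s : ℂ => (c * s ^ 2) ^ (n : ℕ) := by fun_prop
  simpa using (this.tendsto 0).mono_left nhdsWithin_le_nhds

theorem tendsto_neg_one_sub (t : ℂ) (n : ℕ+) :
    Tendsto (fun s : ℂ => -(1 - (t * s ^ 2) ^ (n : ℕ))) (𝓝[≠] 0) (𝓝 (-1)) := by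
  simpa using ((tendsto_const_nhds (x := (1 : ℂ))).sub (tendsto_pow_sq t n)).neg

theorem tendsto_sq_pow (n : ℕ+) :
    Tendsto (fun s : ℂ => (s ^ 2) ^ (n : ℕ)) (𝓝[≠] 0) (𝓝 0) := by
  simpa using tendsto_pow_sq 1 n

theorem tendsto_vec {ι : Type*} {l : Filter ι} {a b : ι → ℂ} {a₀ b₀ : ℂ}
    (ha : Tendsto a l (𝓝 a₀)) (hb : Tendsto b l (𝓝 b₀)) (i : Fin 2) :
    Tendsto (fun s => ![a s, b s] i) l (𝓝 (![a₀, b₀] i)) := by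
  fin_cases i
  · exact ha
  · exact hb

theorem tendsto_vertex_one (n : ℤ) (v : Fock) (m : Fin 2 × ℕ+ →₀ ℕ) :
    Tendsto (fun s : ℂ => (vertex (crysOneC t)
      (fun x => ![-(1 - (t * s ^ 2) ^ (x.2 : ℕ)), 0] x.1) n v).coeff m) (𝓝[≠] 0)
      (𝓝 ((vertex (crysOneC t) crysOneA n v).coeff m)) :=
  tendsto_vertex (α := fun _ => crysOneC t)
    (β := fun (s : ℂ) x => ![-(1 - (t * s ^ 2) ^ (x.2 : ℕ)), 0] x.1)
    (fun _ => tendsto_const_nhds)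
    (fun x => tendsto_vec (tendsto_neg_one_sub t x.2) tendsto_const_nhds x.1) n v m

theorem tendsto_vertex_two (n : ℤ) (v : Fock) (m : Fin 2 × ℕ+ →₀ ℕ) :
    Tendsto (fun s : ℂ => (vertex
      (fun x => ![cN t x.2 * ((s ^ 2) ^ (x.2 : ℕ) - 1), cN t x.2] x.1)
      (fun x => ![0, -(1 - (t * s ^ 2) ^ (x.2 : ℕ))] x.1) n v).coeff m) (𝓝[≠] 0)
      (𝓝 ((vertex (crysTwoC t) crysTwoA n v).coeff m)) :=
  tendsto_vertex
    (α := fun (s : ℂ) x => ![cN t x.2 * ((s ^ 2) ^ (x.2 : ℕ) - 1), cN t x.2] x.1)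
    (β := fun (s : ℂ) x => ![0, -(1 - (t * s ^ 2) ^ (x.2 : ℕ))] x.1)
    (fun x => tendsto_vec
      (by simpa using ((tendsto_sq_pow x.2).sub_const 1).const_mul (cN t x.2))
      tendsto_const_nhds x.1)
    (fun x => tendsto_vec tendsto_const_nhds (tendsto_neg_one_sub t x.2) x.1) n v m

theorem tendsto_vertex_three (n : ℤ) (v : Fock) (m : Fin 2 × ℕ+ →₀ ℕ) :
    Tendsto (fun s : ℂ => (vertex
      (fun x => ![cN t x.2 * (s ^ 2) ^ (x.2 : ℕ), cN t x.2] x.1)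
      (fun x => -(1 - (t * s ^ 2) ^ (x.2 : ℕ))) n v).coeff m) (𝓝[≠] 0)
      (𝓝 ((vertex (crysThreeC t) crysThreeA n v).coeff m)) :=
  tendsto_vertex
    (α := fun (s : ℂ) x => ![cN t x.2 * (s ^ 2) ^ (x.2 : ℕ), cN t x.2] x.1)
    (β := fun (s : ℂ) x => -(1 - (t * s ^ 2) ^ (x.2 : ℕ)))
    (fun x => tendsto_vec
      (by simpa using (tendsto_sq_pow x.2).const_mul (cN t x.2)) tendsto_const_nhds x.1)
    (fun x => tendsto_neg_one_sub t x.2) n v m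

theorem isCrystallization_crys (ht0 : t ≠ 0) (ht : ∀ n : ℕ, 0 < n → t ^ n ≠ 1)
    (u : Fin 2 → ℂ) : IsCrystallization t u (crysX1 t u) (crysX2 t u) := by
  constructor
  · intro n v m
    have h3 := (((tendsto_pow_natAbs_mul_zpow_neg n).mul (tendsto_vertex_one (t := t) n v m)).const_mul (u 0)).add
      (((tendsto_pow_natAbs_mul_zpow n).mul (tendsto_vertex_two (t := t) n v m)).const_mul (u 1))
    have h4 : (crysX1 t u n v).coeff m =
        u 0 * ((if 0 ≤ n then 1 else 0) * (vertex (crysOneC t) crysOneA n v).coeff m) +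
        u 1 * ((if n ≤ 0 then 1 else 0) * (vertex (crysTwoC t) crysTwoA n v).coeff m) := by
      simp only [crysX1, LinearMap.add_apply, LinearMap.smul_apply, MvPolynomial.coeff_add,
        MvPolynomial.coeff_smul, smul_eq_mul, mul_assoc]
    rw [h4]
    refine h3.congr' ?_
    filter_upwards [self_mem_nhdsWithin] with s hs
    rw [X1_eq ht, vertex_lamOne hs, vertex_lamTwo hs]
    simp only [MvPolynomial.coeff_add, MvPolynomial.coeff_smul, smul_eq_mul]
    ring
  · intro n v m
    refine ⟨fun s => u 1 * u 0 *
      (vertex ((fun x => ((s ^ 2)⁻¹)⁻¹ ^ (x.2 : ℕ) * lamTwoC t s x) + lamOneC t s)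
        ((fun x => (s ^ 2)⁻¹ ^ (x.2 : ℕ) * lamTwoA t s x) + lamOneA t s) n v).coeff m, ?_, ?_⟩
    -- Near `s = 0` both q = t s² and s⁴ differ from 1.
    · filter_upwards [self_mem_nhdsWithin,
        (show Tendsto (fun s : ℂ => t * s ^ 2) (𝓝[≠] 0) (𝓝 0) by
          simpa using tendsto_pow_sq t 1).eventually_ne (zero_ne_one),
        (show Tendsto (fun s : ℂ => s ^ 4) (𝓝[≠] 0) (𝓝 0) by
          simpa [← pow_mul] using tendsto_sq_pow 2).eventually_ne (zero_ne_one)] with s hs hq hp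
      exact isX2Coeff ht0 ht u hs hq hp n v m
    · refine ((tendsto_vertex_three (t := t) n v m).const_mul (u 1 * u 0)).congr' ?_
      filter_upwards [self_mem_nhdsWithin] with s hs
      rw [vertex_lamTwoOne hs, MvPolynomial.coeff_smul, smul_eq_mul, zpow_neg]
      have : s ^ n ≠ 0 := zpow_ne_zero n hs
      field_simp

/-- Two choices of values for X^{(2)} agree near s = 0 by uniqueness of expansion values, and limits
in ℂ are unique. -/
theorem IsCrystallization.unique {u : Fin 2 → ℂ} {Y1 Y2 Z1 Z2 : ℤ → Op}
    (h : IsCrystallization t u Y1 Y2) (h' : IsCrystallization t u Z1 Z2) :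
    Y1 = Z1 ∧ Y2 = Z2 := by
  constructor
  · refine funext fun n => LinearMap.ext fun v => MvPolynomial.ext _ _ fun m => ?_
    exact tendsto_nhds_unique (h.first n v m) (h'.first n v m)
  · refine funext fun n => LinearMap.ext fun v => MvPolynomial.ext _ _ fun m => ?_
    obtain ⟨x, hx, hx'⟩ := h.second n v m
    obtain ⟨z, hz, hz'⟩ := h'.second n v m
    refine tendsto_nhds_unique (hx'.congr' ?_) hz'
    filter_upwards [self_mem_nhdsWithin, hx, hz] with s hs h1 h2
    rw [IsExpansionValue.unique (inv_ne_zero (pow_ne_zero 2 hs)) h1 h2]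

end Limits

/-! ### Unitriangular families of polynomials. -/

section Triangular
variable {σ : Type*} (e w : σ → ℕ)

/-- An exponent vector, compared with others at the largest index where they differ. -/
noncomputable def expKey (κ : σ →₀ ℕ) : Colex (ℕ →₀ ℕ) := toColex (κ.mapDomain e)

/-- The polynomial `f` is the monomial with exponents `κ` plus larger monomials of the same weight. -/
def IsTriangular (κ : σ →₀ ℕ) (f : MvPolynomial σ ℂ) : Prop :=
  f.coeff κ = 1 ∧ ∀ ν, f.coeff ν ≠ 0 →
    expKey e κ ≤ expKey e ν ∧ Finsupp.weight w ν = Finsupp.weight w κ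

variable {e w}

theorem expKey_add (κ ν : σ →₀ ℕ) : expKey e (κ + ν) = expKey e κ + expKey e ν := by
  rw [expKey, Finsupp.mapDomain_add]
  rfl

theorem expKey_injective (he : Function.Injective e) : Function.Injective (expKey e) :=
  fun _ _ h => Finsupp.mapDomain_injective he (toColex.injective h)

/-- The order on exponents is strictly compatible with addition, so the lowest monomial of the
product arises only from the two lowest monomials. -/
theorem IsTriangular.mul (he : Function.Injective e) {κ κ' : σ →₀ ℕ} {f f' : MvPolynomial σ ℂ}
    (h : IsTriangular e w κ f) (h' : IsTriangular e w κ' f') :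
    IsTriangular e w (κ + κ') (f * f') := by
  classical
  constructor
  · rw [MvPolynomial.coeff_mul, Finset.sum_eq_single_of_mem (κ, κ')
      (Finset.HasAntidiagonal.mem_antidiagonal.2 rfl), h.1, h'.1, mul_one]
    rintro ⟨ν, ν'⟩ hν hne
    rw [Finset.HasAntidiagonal.mem_antidiagonal] at hν
    by_contra h0
    obtain ⟨h1, -⟩ := h.2 ν (left_ne_zero_of_mul h0)
    obtain ⟨h2, -⟩ := h'.2 ν' (right_ne_zero_of_mul h0)
    have h3 : expKey e ν + expKey e ν' = expKey e κ + expKey e κ' := by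
      rw [← expKey_add, ← expKey_add]
      exact congrArg _ hν
    have h4 : expKey e ν = expKey e κ := by
      by_contra h5
      exact absurd h3 (add_lt_add_of_lt_of_le (lt_of_le_of_ne h1 (Ne.symm h5)) h2).ne'
    rw [h4] at h3
    exact hne (Prod.ext (expKey_injective he h4) (expKey_injective he (add_left_cancel h3)))
  · intro ν hν
    rw [MvPolynomial.coeff_mul] at hν
    obtain ⟨⟨a, b⟩, hab, h0⟩ := Finset.exists_ne_zero_of_sum_ne_zero hν
    rw [Finset.HasAntidiagonal.mem_antidiagonal] at hab
    obtain ⟨h1, h2⟩ := h.2 a (left_ne_zero_of_mul h0)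
    obtain ⟨h3, h4⟩ := h'.2 b (right_ne_zero_of_mul h0)
    simp only at hab
    rw [← hab, expKey_add, expKey_add, map_add, map_add, h2, h4]
    exact ⟨add_le_add h1 h3, rfl⟩

theorem IsTriangular.rename {τ : Type*} {e' w' : τ → ℕ} {g : σ → τ} (hg : Function.Injective g)
    {κ : σ →₀ ℕ} {f : MvPolynomial σ ℂ} (h : IsTriangular (e' ∘ g) (w' ∘ g) κ f) :
    IsTriangular e' w' (κ.mapDomain g) (MvPolynomial.rename g f) := by
  have hkey : ∀ ν : σ →₀ ℕ, expKey e' (ν.mapDomain g) = expKey (e' ∘ g) ν := fun ν => by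
    rw [expKey, ← Finsupp.mapDomain_comp]
    rfl
  have hweight : ∀ ν : σ →₀ ℕ,
      Finsupp.weight w' (ν.mapDomain g) = Finsupp.weight (w' ∘ g) ν := fun ν => by
    rw [Finsupp.weight_apply, Finsupp.weight_apply, Finsupp.sum_mapDomain_index (by simp)
      (fun _ _ _ => add_smul _ _ _)]
    rfl
  refine ⟨by rw [MvPolynomial.coeff_rename_mapDomain g hg, h.1], fun ν hν => ?_⟩
  obtain ⟨μ, rfl, hμ⟩ := MvPolynomial.coeff_rename_ne_zero g f ν hν
  rw [hkey, hkey, hweight, hweight]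
  exact h.2 μ hμ

variable {ι : Type*} {κ : ι → σ →₀ ℕ} {b : ι → MvPolynomial σ ℂ}

/-- In a linear relation the smallest leading monomial that occurs cannot be cancelled by the other
terms. -/
theorem linearIndependent_of_isTriangular (he : Function.Injective e)
    (hκ : Function.Injective κ) (hb : ∀ i, IsTriangular e w (κ i) (b i)) :
    LinearIndependent ℂ b := by
  rw [linearIndependent_iff]
  intro l hl
  by_contra h0
  obtain ⟨i, hi, hmin⟩ := Finset.exists_min_image l.support (fun i => expKey e (κ i))
    (Finsupp.support_nonempty_iff.2 h0)
  have h1 := congrArg (MvPolynomial.coeff (κ i)) hl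
  rw [Finsupp.linearCombination_apply, Finsupp.sum, MvPolynomial.coeff_sum, MvPolynomial.coeff_zero,
    Finset.sum_eq_single_of_mem i hi, MvPolynomial.coeff_smul, (hb i).1, smul_eq_mul, mul_one] at h1
  · exact Finsupp.mem_support_iff.1 hi h1
  · intro j hj hne
    rw [MvPolynomial.coeff_smul, smul_eq_mul]
    by_contra h2
    have h3 := ((hb j).2 (κ i) (right_ne_zero_of_mul h2)).1
    exact hne (hκ (expKey_injective he (le_antisymm h3 (hmin j hj))))

theorem finite_weight_eq (hw : ∀ d, {x | w x ≤ d}.Finite) (hw0 : ∀ x, w x ≠ 0) (d : ℕ) :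
    {ν : σ →₀ ℕ | Finsupp.weight w ν = d}.Finite := by
  classical
  refine ((hw d).toFinset.finsupp fun _ => Finset.range (d + 1)).finite_toSet.subset ?_
  rintro ν rfl
  rw [Finset.mem_coe, Finset.mem_finsupp_iff]
  refine ⟨fun x hx => ?_, fun x _ => ?_⟩
  · simpa using Finsupp.le_weight_of_ne_zero' w (Finsupp.mem_support_iff.1 hx)
  · rw [Finset.mem_range, Nat.lt_succ_iff]
    exact Finsupp.le_weight w (hw0 x) ν

/-- Only finitely many monomials have a given weight, so monomials can be eliminated from the
largest down, by induction on the number of larger monomials of the same weight. -/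
theorem span_of_isTriangular (he : Function.Injective e) (hw : ∀ d, {x | w x ≤ d}.Finite)
    (hw0 : ∀ x, w x ≠ 0) (hκ : Function.Surjective κ)
    (hb : ∀ i, IsTriangular e w (κ i) (b i)) : Submodule.span ℂ (Set.range b) = ⊤ := by
  classical
  suffices H : ∀ (N : ℕ) (ν : σ →₀ ℕ),
      {μ | Finsupp.weight w μ = Finsupp.weight w ν ∧ expKey e ν < expKey e μ}.ncard = N →
        MvPolynomial.monomial ν (1 : ℂ) ∈ Submodule.span ℂ (Set.range b) by
    rw [eq_top_iff]
    intro f _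
    rw [MvPolynomial.as_sum f]
    refine Submodule.sum_mem _ fun ν _ => ?_
    rw [← mul_one (f.coeff ν), ← smul_eq_mul, ← MvPolynomial.smul_monomial]
    exact Submodule.smul_mem _ _ (H _ ν rfl)
  intro N
  induction N using Nat.strong_induction_on with
  | _ N ih =>
    intro ν hN
    obtain ⟨i, rfl⟩ := hκ ν
    have h1 : MvPolynomial.monomial (κ i) (1 : ℂ) =
        b i - ∑ μ ∈ (b i).support.erase (κ i), (b i).coeff μ • MvPolynomial.monomial μ 1 := by
      have hmem : κ i ∈ (b i).support := by
        rw [MvPolynomial.mem_support_iff, (hb i).1]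
        exact one_ne_zero
      have h2 := MvPolynomial.as_sum (b i)
      rw [← Finset.add_sum_erase _ _ hmem, (hb i).1] at h2
      rw [eq_sub_iff_add_eq]
      refine Eq.trans ?_ h2.symm
      congr 1
      exact Finset.sum_congr rfl fun μ _ => by
        rw [MvPolynomial.smul_monomial, smul_eq_mul, mul_one]
    rw [h1]
    refine Submodule.sub_mem _ (Submodule.subset_span ⟨i, rfl⟩)
      (Submodule.sum_mem _ fun μ hμ => Submodule.smul_mem _ _ ?_)
    rw [Finset.mem_erase, MvPolynomial.mem_support_iff] at hμ
    obtain ⟨h3, h4⟩ := (hb i).2 μ hμ.2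
    have h5 : expKey e (κ i) < expKey e μ :=
      lt_of_le_of_ne h3 fun h => hμ.1 (expKey_injective he h).symm
    refine ih _ ?_ μ rfl
    rw [← hN]
    refine Set.ncard_lt_ncard (Set.ssubset_iff_of_subset ?_ |>.2 ⟨μ, ⟨h4, h5⟩, fun h => h.2.false⟩)
      ((finite_weight_eq hw hw0 (Finsupp.weight w (κ i))).subset fun x hx => hx.1)
    exact fun x hx => ⟨hx.1.trans h4, h5.trans hx.2⟩

end Triangular

/-! ### Triangularity of the modes of one vertex operator. -/

section HallLittlewood
variable (α β : Fin 2 × ℕ+ → ℂ)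

/-- The homomorphism from polynomials in `x_n`, `n ≥ 1`, that sends `x_n` to the coefficient of `z^n`
in `creationSeries α`. -/
noncomputable def creationHom : MvPolynomial ℕ+ ℂ →ₐ[ℂ] Fock :=
  MvPolynomial.aeval fun n : ℕ+ => creationCoeff α (n : ℕ)

/-- The polynomials in the ideal generated by the variables `x_k` with `k > n`. -/
noncomputable def largeIdeal (n : ℕ) : Ideal (MvPolynomial ℕ+ ℂ) :=
  Ideal.span (MvPolynomial.X '' {k : ℕ+ | n < k})

/-- The weights `n` of the variables `x_n`. -/
abbrev pnatWeight (n : ℕ+) : ℕ := n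

/-- The raising property of the vertex operator with modes `vertex α β (-n)` on a polynomial of
weight `d`: its leading term is multiplication by `x_n`. -/
def IsRaised (d : ℕ) (f : MvPolynomial ℕ+ ℂ) : Prop :=
  f.IsWeightedHomogeneous pnatWeight d ∧ ∀ n : ℕ+, ∃ g ∈ largeIdeal n,
    g.IsWeightedHomogeneous pnatWeight (n + d) ∧
    vertex α β (-(n : ℕ)) (creationHom α f) = creationHom α (MvPolynomial.X n * f + g)

variable {α β}

theorem largeIdeal_anti {m n : ℕ} (h : m ≤ n) : largeIdeal n ≤ largeIdeal m :=
  Ideal.span_mono (Set.image_mono fun _ hk => lt_of_le_of_lt h hk)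

theorem IsRaised.add {d : ℕ} {f g : MvPolynomial ℕ+ ℂ} (hf : IsRaised α β d f)
    (hg : IsRaised α β d g) : IsRaised α β d (f + g) := by
  refine ⟨hf.1.add hg.1, fun n => ?_⟩
  obtain ⟨f', h1, h2, h3⟩ := hf.2 n
  obtain ⟨g', h4, h5, h6⟩ := hg.2 n
  refine ⟨f' + g', Ideal.add_mem _ h1 h4, h2.add h5, ?_⟩
  rw [map_add, map_add, h3, h6, ← map_add]
  exact congrArg _ (by ring)

theorem IsRaised.smul {d : ℕ} {f : MvPolynomial ℕ+ ℂ} (hf : IsRaised α β d f) (c : ℂ) :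
    IsRaised α β d (c • f) := by
  refine ⟨Submodule.smul_mem (MvPolynomial.weightedHomogeneousSubmodule ℂ _ d) c hf.1,
    fun n => ?_⟩
  obtain ⟨g, h1, h2, h3⟩ := hf.2 n
  refine ⟨c • g, Submodule.smul_of_tower_mem _ c h1,
    Submodule.smul_mem (MvPolynomial.weightedHomogeneousSubmodule ℂ _ _) c h2, ?_⟩
  rw [map_smul, map_smul, h3, ← map_smul, smul_add, mul_smul_comm]

theorem vertex_one (n : ℤ) : vertex α β n 1 = creationCoeff α (-n) := by
  rw [vertex_apply, map_one, ← Polynomial.monomial_zero_one, contract_monomial]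
  simp

theorem isRaised_one : IsRaised α β 0 1 := by
  refine ⟨MvPolynomial.isWeightedHomogeneous_one ℂ _, fun n =>
    ⟨0, Ideal.zero_mem _, MvPolynomial.isWeightedHomogeneous_zero ℂ _ _, ?_⟩⟩
  rw [map_one, vertex_one, mul_one, add_zero, creationHom, MvPolynomial.aeval_X, neg_neg]

theorem isWeightedHomogeneous_X_pnat (n : ℕ+) :
    (MvPolynomial.X n : MvPolynomial ℕ+ ℂ).IsWeightedHomogeneous pnatWeight (n : ℕ) :=
  MvPolynomial.isWeightedHomogeneous_X ℂ _ n

theorem creationHom_X (n : ℕ+) :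
    creationHom α (MvPolynomial.X n) = creationCoeff α (n : ℕ) := by
  rw [creationHom, MvPolynomial.aeval_X]

theorem exists_creationHom_eq (k : ℕ) : ∃ y : MvPolynomial ℕ+ ℂ,
    y.IsWeightedHomogeneous pnatWeight k ∧ creationHom α y = creationCoeff α k := by
  rcases Nat.eq_zero_or_pos k with rfl | h
  · refine ⟨1, MvPolynomial.isWeightedHomogeneous_one ℂ _, ?_⟩
    rw [map_one, Nat.cast_zero, creationCoeff_zero]
  · lift k to ℕ+ using h
    exact ⟨MvPolynomial.X k, isWeightedHomogeneous_X_pnat k, creationHom_X k⟩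

/-- Commute the mode past E_a by the exchange relation. The term of order 0 has the expected leading
part, and every later term has a mode of larger index, hence lies in the ideal of the larger
variables. -/
theorem IsRaised.X_mul {d : ℕ} {f : MvPolynomial ℕ+ ℂ} (hf : IsRaised α β d f) (a : ℕ+) :
    IsRaised α β (a + d) (MvPolynomial.X a * f) := by
  refine ⟨(isWeightedHomogeneous_X_pnat a).mul hf.1, fun n => ?_⟩
  choose y hy hy' using exists_creationHom_eq (α := α)
  choose g hg hg' hg'' using hf.2
  -- The term of order `j + 1` of the exchange relation, with `y k` a preimage of E_k.
  let h : ℕ → MvPolynomial ℕ+ ℂ := fun j =>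
    PowerSeries.coeff (j + 1) (exchangeFactor β α) •
      (y (a - (j + 1)) * (MvPolynomial.X (n + j.succPNat) * f + g (n + j.succPNat)))
  have hX : ∀ j : ℕ, (MvPolynomial.X (n + j.succPNat) : MvPolynomial ℕ+ ℂ) ∈ largeIdeal n :=
    fun j => Ideal.subset_span ⟨_, PNat.lt_add_right _ _, rfl⟩
  refine ⟨MvPolynomial.X a * g n + ∑ j ∈ Finset.range a, h j, ?_, ?_, ?_⟩
  · refine Ideal.add_mem _ (Ideal.mul_mem_left _ _ (hg n)) (Ideal.sum_mem _ fun j _ => ?_)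
    refine Submodule.smul_of_tower_mem _ _ (Ideal.mul_mem_left _ _ (Ideal.add_mem _
      (Ideal.mul_mem_right _ _ (hX j)) (largeIdeal_anti ?_ (hg _))))
    simp
  · refine MvPolynomial.IsWeightedHomogeneous.add ?_ ?_
    · rw [add_left_comm]
      exact (isWeightedHomogeneous_X_pnat a).mul (hg' n)
    · refine Submodule.sum_mem (MvPolynomial.weightedHomogeneousSubmodule ℂ _ _) fun j hj =>
        Submodule.smul_mem _ _ ?_
      have hj : j + 1 ≤ a := Finset.mem_range.1 hj
      have h1 := (hy (a - (j + 1))).mul (MvPolynomial.IsWeightedHomogeneous.add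
        ((isWeightedHomogeneous_X_pnat (n + j.succPNat)).mul hf.1) (hg' (n + j.succPNat)))
      rw [MvPolynomial.mem_weightedHomogeneousSubmodule]
      convert h1 using 1
      simp only [PNat.add_coe, Nat.succPNat_coe]
      omega
  · rw [map_mul, creationHom_X,
      vertex_creationCoeff_mul α β α _ (show ((a : ℕ) : ℤ) < (a + 1 : ℕ) by omega),
      Finset.sum_range_succ']
    rw [coeff_zero_exchangeFactor, one_smul, Nat.cast_zero, sub_zero, sub_zero, hg'' n,
      add_comm (Finset.sum _ _), ← add_assoc (MvPolynomial.X n * _), map_add (creationHom α) (_ + _),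
      map_sum]
    congr 1
    · rw [← creationHom_X, ← map_mul (creationHom α)]
      exact congrArg _ (by ring)
    · refine Finset.sum_congr rfl fun j hj => ?_
      have hj : j + 1 ≤ a := Finset.mem_range.1 hj
      rw [map_smul, map_mul (creationHom α), hy', ← hg'']
      rw [show ((a : ℕ) : ℤ) - (j + 1 : ℕ) = ((a : ℕ) - (j + 1) : ℕ) by omega,
        show -((n : ℕ) : ℤ) - (j + 1 : ℕ) = -((n + j.succPNat : ℕ+) : ℕ) by
          rw [PNat.add_coe, Nat.succPNat_coe]; push_cast; ring]

theorem isRaised_monomial (ν : ℕ+ →₀ ℕ) :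
    IsRaised α β (Finsupp.weight pnatWeight ν) (MvPolynomial.monomial ν 1) := by
  classical
  obtain ⟨m, rfl⟩ := Multiset.toFinsupp.surjective ν
  induction m using Multiset.induction_on with
  | empty => simpa using isRaised_one
  | cons a m ih =>
    have h1 := ih.X_mul a
    rw [← Multiset.singleton_add, map_add, Multiset.toFinsupp_singleton, map_add,
      Finsupp.weight_single, ← one_mul (1 : ℂ), ← MvPolynomial.monomial_mul]
    simpa [MvPolynomial.X] using h1

theorem isRaised_of_isWeightedHomogeneous {d : ℕ} {f : MvPolynomial ℕ+ ℂ}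
    (hf : f.IsWeightedHomogeneous pnatWeight d) : IsRaised α β d f := by
  have h0 : IsRaised α β d 0 := by
    refine ⟨MvPolynomial.isWeightedHomogeneous_zero ℂ _ _, fun n =>
      ⟨0, Ideal.zero_mem _, MvPolynomial.isWeightedHomogeneous_zero ℂ _ _, by simp⟩⟩
  rw [MvPolynomial.as_sum f]
  refine Finset.sum_induction _ (IsRaised α β d) (fun _ _ => IsRaised.add) h0 fun ν hν => ?_
  rw [← mul_one (f.coeff ν), ← smul_eq_mul, ← MvPolynomial.smul_monomial,
    ← hf (MvPolynomial.mem_support_iff.1 hν)]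
  exact (isRaised_monomial ν).smul _

/-- When n is at least every index in κ, the correction terms contain a variable beyond all those of
the new leading monomial, so they are larger at the highest place of difference. -/
theorem IsTriangular.raise {e : ℕ+ → ℕ} (he : StrictMono e) {κ : ℕ+ →₀ ℕ}
    {f : MvPolynomial ℕ+ ℂ} (hf : IsTriangular e pnatWeight κ f) {n : ℕ+}
    (hn : ∀ k, κ k ≠ 0 → k ≤ n) :
    ∃ g, IsTriangular e pnatWeight (κ + Finsupp.single n 1) g ∧
      vertex α β (-(n : ℕ)) (creationHom α f) = creationHom α g := by
  obtain ⟨-, h⟩ := isRaised_of_isWeightedHomogeneous (α := α) (β := β)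
    (show f.IsWeightedHomogeneous pnatWeight (Finsupp.weight pnatWeight κ) from
      fun ν hν => (hf.2 ν hν).2)
  obtain ⟨g, hg, hgw, hgv⟩ := h n
  have hlarge : ∀ ν, g.coeff ν ≠ 0 → ∃ k : ℕ+, n < k ∧ ν k ≠ 0 := fun ν hν => by
    simpa using MvPolynomial.mem_ideal_span_X_image.1 hg ν (MvPolynomial.mem_support_iff.2 hν)
  have hsmall : ∀ k, (κ + Finsupp.single n 1 : ℕ+ →₀ ℕ) k ≠ 0 → k ≤ n := by
    intro k hk
    rcases eq_or_ne k n with rfl | hne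
    · exact le_rfl
    · exact hn k (by simpa [Finsupp.single_apply, hne.symm] using hk)
  refine ⟨MvPolynomial.X n * f + g, ⟨?_, fun ν hν => ?_⟩, hgv⟩
  · rw [MvPolynomial.coeff_add, add_comm κ, MvPolynomial.X, MvPolynomial.coeff_monomial_mul, hf.1,
      one_mul, add_eq_left]
    by_contra h0
    obtain ⟨k, hk, hk'⟩ := hlarge _ h0
    rw [add_comm] at hk'
    exact absurd (hsmall k hk') (not_le.2 hk)
  · rw [MvPolynomial.coeff_add] at hν
    by_cases h0 : g.coeff ν = 0
    · rw [h0, add_zero, mul_comm, MvPolynomial.coeff_mul_X'] at hν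
      split_ifs at hν with hs
      · obtain ⟨h1, h2⟩ := hf.2 _ hν
        have h3 : ν = (ν - Finsupp.single n 1) + Finsupp.single n 1 :=
          (tsub_add_cancel_of_le (Finsupp.single_le_iff.2
            (Nat.one_le_iff_ne_zero.2 (Finsupp.mem_support_iff.1 hs)))).symm
        rw [h3, expKey_add, expKey_add, map_add, map_add, h2]
        exact ⟨add_le_add_left h1 _, rfl⟩
      · exact absurd rfl hν
    · refine ⟨?_, ?_⟩
      · obtain ⟨k, hk, hk'⟩ := hlarge ν h0
        by_contra hlt
        -- If a monomial of `g` were smaller, the deciding place would be some index at most `n`;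
        -- the two exponents would then agree at `k > n`, where only one of them vanishes.
        obtain ⟨i, hi, hi'⟩ := Finsupp.Colex.lt_iff.1 (not_le.1 hlt)
        have h1 : (κ + Finsupp.single n 1).mapDomain e i ≠ 0 :=
          (lt_of_le_of_lt (Nat.zero_le _) hi').ne'
        obtain ⟨j, rfl⟩ : ∃ j, e j = i := by
          by_contra h2
          exact h1 (Finsupp.mapDomain_of_notMem_range _ _ h2)
        rw [Finsupp.mapDomain_apply he.injective] at h1
        have h2 : ν.mapDomain e (e k) = (κ + Finsupp.single n 1).mapDomain e (e k) :=
          hi (e k) (he ((hsmall j h1).trans_lt hk))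
        rw [Finsupp.mapDomain_apply he.injective, Finsupp.mapDomain_apply he.injective] at h2
        exact absurd (hsmall k (h2 ▸ hk')) (not_le.2 hk)
      · rw [hgw h0, map_add, Finsupp.weight_single, add_comm]
        simp

/-- The exponent vector that counts the parts of a list. -/
noncomputable def partCount (L : List ℕ) : ℕ+ →₀ ℕ :=
  (L.map fun k => Finsupp.single k.toPNat' 1).sum

theorem exists_of_partCount_ne_zero {L : List ℕ} {k : ℕ+} (h : partCount L k ≠ 0) :
    ∃ n ∈ L, n.toPNat' = k := by
  induction L with
  | nil => simp [partCount] at h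
  | cons n L ih =>
    rw [partCount, List.map_cons, List.sum_cons, Finsupp.add_apply, Finsupp.single_apply] at h
    split_ifs at h with hn
    · exact ⟨n, by simp, hn⟩
    · obtain ⟨m, hm, hm'⟩ := ih (by simpa [partCount] using h)
      exact ⟨m, by simp [hm], hm'⟩

/-- The rightmost operator acts first and the list decreases, so every mode acts on a polynomial
whose leading monomial involves only parts that are no larger. -/
theorem exists_isTriangular_prod {e : ℕ+ → ℕ} (he : StrictMono e) {L : List ℕ}
    (hL : L.SortedGE) (hpos : ∀ k ∈ L, 0 < k) :
    ∃ f, IsTriangular e pnatWeight (partCount L) f ∧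
      (L.map fun k : ℕ => vertex α β (-(k : ℤ))).prod 1 = creationHom α f := by
  induction L with
  | nil =>
    refine ⟨1, ⟨by simp [partCount], fun ν hν => ?_⟩, by simp⟩
    rw [MvPolynomial.coeff_one] at hν
    split_ifs at hν with h
    · subst h
      exact ⟨le_rfl, rfl⟩
    · exact absurd rfl hν
  | cons n L ih =>
    have hL' := List.pairwise_cons.1 hL.pairwise
    obtain ⟨f, hf, hf'⟩ := ih hL'.2.sortedGE fun k hk => hpos k (by simp [hk])
    have hn : ((n.toPNat' : ℕ+) : ℕ) = n := by
      rw [Nat.toPNat'_coe, if_pos (hpos n (by simp))]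
    obtain ⟨g, hg, hg'⟩ := hf.raise (α := α) (β := β) he (n := n.toPNat') fun k hk => by
      obtain ⟨m, hm, rfl⟩ := exists_of_partCount_ne_zero hk
      rw [← PNat.coe_le_coe, hn, Nat.toPNat'_coe, if_pos (hpos m (by simp [hm]))]
      exact hL'.1 m hm
    refine ⟨g, ?_, ?_⟩
    · rwa [partCount, List.map_cons, List.sum_cons, add_comm]
    · rw [List.map_cons, List.prod_cons, Module.End.mul_apply, hf', ← hg', hn]

end HallLittlewood

/-! ### Creation coefficients as free generators of the Fock space. -/

section Automorphism

/-- The substitution that replaces `x_{i,n}` by the coefficient of `z^n` in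
`exp (∑_{k ≥ 1} x_{i,k} z^k)`. -/
noncomputable def expHom : Fock →ₐ[ℂ] Fock :=
  MvPolynomial.aeval fun x =>
    PowerSeries.coeff x.2 (creationSeries fun y => if y.1 = x.1 then 1 else 0)

theorem coeff_single_mixedCurrent {A : Type*} [Ring A] [Algebra ℂ A] (i : Fin 2)
    (a : Fin 2 × ℕ+ → A) (n : ℕ+) :
    PowerSeries.coeff n (mixedCurrent (fun y => if y.1 = i then 1 else 0) a) = a (i, n) := by
  simp [coeff_mixedCurrent]

/-- The inverse substitution is read off from the logarithm of 1 + ∑ x_{i,k} z^k. -/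
theorem bijective_expHom : Function.Bijective expHom := by
  have hlog : ∀ i : Fin 2, ∃ g : PowerSeries Fock, PowerSeries.coeff 0 g = 0 ∧ pexp g =
      1 + mixedCurrent (fun y => if y.1 = i then 1 else 0) MvPolynomial.X := fun i =>
    exists_pexp_eq (by rw [map_add, coeff_zero_mixedCurrent]; simp)
  choose g hg0 hg using hlog
  let ψ : Fock →ₐ[ℂ] Fock := MvPolynomial.aeval fun x => PowerSeries.coeff x.2 (g x.1)
  have h1 : ψ.comp expHom = AlgHom.id ℂ Fock := by
    refine MvPolynomial.algHom_ext fun ⟨i, n⟩ => ?_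
    have h2 : PowerSeries.map (ψ : Fock →+* Fock)
        (mixedCurrent (fun y => if y.1 = i then 1 else 0) MvPolynomial.X) = g i := by
      rw [map_mixedCurrent]
      refine ext_mixedCurrent ((coeff_zero_mixedCurrent _ _).trans (hg0 i).symm) fun n => ?_
      rw [coeff_single_mixedCurrent]
      simp [ψ]
    have h3 := congrArg (PowerSeries.coeff (n : ℕ)) (map_pexp ψ
      (mixedCurrent (fun y => if y.1 = i then 1 else 0) MvPolynomial.X))
    rw [h2, hg, PowerSeries.coeff_map, map_add, coeff_single_mixedCurrent, PowerSeries.coeff_one,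
      if_neg n.ne_zero, zero_add] at h3
    rw [AlgHom.comp_apply, expHom, MvPolynomial.aeval_X]
    exact h3
  have h4 : expHom.comp ψ = AlgHom.id ℂ Fock := by
    refine MvPolynomial.algHom_ext fun ⟨i, n⟩ => ?_
    have h5 : PowerSeries.map (expHom : Fock →+* Fock) (g i) =
        mixedCurrent (fun y => if y.1 = i then 1 else 0) MvPolynomial.X := by
      refine pexp_injective (by rw [PowerSeries.coeff_map, hg0, map_zero])
        (coeff_zero_mixedCurrent _ _) ?_
      rw [← map_pexp, hg, map_add, map_one, map_mixedCurrent]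
      refine ext_mixedCurrent ?_ fun n => ?_
      · rw [map_add, coeff_zero_mixedCurrent, coeff_zero_pexp]
        simp
      · rw [map_add, coeff_single_mixedCurrent, PowerSeries.coeff_one, if_neg n.ne_zero, zero_add,
          expHom, MvPolynomial.aeval_X]
        rfl
    have h6 := congrArg (PowerSeries.coeff (n : ℕ)) h5
    rw [PowerSeries.coeff_map, coeff_single_mixedCurrent] at h6
    rw [AlgHom.comp_apply, show ψ (MvPolynomial.X (i, n)) = PowerSeries.coeff n (g i) by
      simp [ψ]]
    exact h6
  exact Function.bijective_iff_has_inverse.2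
    ⟨ψ, fun f => congrArg (fun φ : Fock →ₐ[ℂ] Fock => φ f) h1,
      fun f => congrArg (fun φ : Fock →ₐ[ℂ] Fock => φ f) h4⟩

/-- The linear substitution `x_{i,n} ↦ ∑_j (M_n)_{i,j} x_{j,n}`. -/
noncomputable def linearHom (M : ℕ+ → Matrix (Fin 2) (Fin 2) ℂ) : Fock →ₐ[ℂ] Fock :=
  MvPolynomial.aeval fun x => ∑ j, M x.2 x.1 j • MvPolynomial.X (j, x.2)

theorem linearHom_comp (M M' : ℕ+ → Matrix (Fin 2) (Fin 2) ℂ) :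
    (linearHom M).comp (linearHom M') = linearHom fun n => M' n * M n := by
  refine MvPolynomial.algHom_ext fun ⟨i, n⟩ => ?_
  simp only [linearHom, AlgHom.comp_apply, MvPolynomial.aeval_X, map_sum, map_smul,
    Matrix.mul_apply, Finset.sum_smul, Finset.smul_sum, smul_smul]
  exact Finset.sum_comm

theorem linearHom_one : linearHom (fun _ => 1) = AlgHom.id ℂ Fock := by
  refine MvPolynomial.algHom_ext fun ⟨i, n⟩ => ?_
  simp [linearHom, Matrix.one_apply]

theorem bijective_linearHom {M : ℕ+ → Matrix (Fin 2) (Fin 2) ℂ} (hM : ∀ n, IsUnit (M n).det) :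
    Function.Bijective (linearHom M) := by
  have h1 : (linearHom M).comp (linearHom fun n => (M n)⁻¹) = AlgHom.id ℂ Fock := by
    simp only [linearHom_comp, Matrix.nonsing_inv_mul _ (hM _), linearHom_one]
  have h2 : (linearHom fun n => (M n)⁻¹).comp (linearHom M) = AlgHom.id ℂ Fock := by
    simp only [linearHom_comp, Matrix.mul_nonsing_inv _ (hM _), linearHom_one]
  exact Function.bijective_iff_has_inverse.2
    ⟨linearHom fun n => (M n)⁻¹, fun f => congrArg (fun φ : Fock →ₐ[ℂ] Fock => φ f) h2,
      fun f => congrArg (fun φ : Fock →ₐ[ℂ] Fock => φ f) h1⟩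

variable (α : Fin 2 → Fin 2 × ℕ+ → ℂ)

/-- The homomorphism that sends `x_{i,n}` to the coefficient of `z^n` in `creationSeries (α i)`. -/
noncomputable def creationHomPair : Fock →ₐ[ℂ] Fock :=
  (linearHom fun n => Matrix.of fun i j => α i (j, n)).comp expHom

theorem creationHomPair_X (x : Fin 2 × ℕ+) :
    creationHomPair α (MvPolynomial.X x) = creationCoeff (α x.1) (x.2 : ℕ) := by
  obtain ⟨i, n⟩ := x
  rw [creationHomPair, AlgHom.comp_apply, expHom, MvPolynomial.aeval_X, creationCoeff_natCast,
    creationSeries, creationSeries]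
  have h1 := congrArg (PowerSeries.coeff (n : ℕ)) (map_pexp
    (linearHom fun n => Matrix.of fun i j => α i (j, n))
    (mixedCurrent (fun y => if y.1 = i then 1 else 0) MvPolynomial.X))
  rw [PowerSeries.coeff_map, map_mixedCurrent] at h1
  refine h1.trans (congrArg (fun g => PowerSeries.coeff (n : ℕ) (pexp g)) ?_)
  refine ext_mixedCurrent ((coeff_zero_mixedCurrent _ _).trans (coeff_zero_mixedCurrent _ _).symm)
    fun n => ?_
  rw [coeff_single_mixedCurrent, coeff_mixedCurrent, linearHom, MvPolynomial.aeval_X]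
  rfl

theorem creationHomPair_rename (i : Fin 2) (f : MvPolynomial ℕ+ ℂ) :
    creationHomPair α (MvPolynomial.rename (fun n => (i, n)) f) = creationHom (α i) f := by
  have h : (creationHomPair α).comp (MvPolynomial.rename fun n => (i, n)) = creationHom (α i) := by
    refine MvPolynomial.algHom_ext fun n => ?_
    rw [AlgHom.comp_apply, MvPolynomial.rename_X, creationHomPair_X, creationHom_X]
  exact congrArg (fun φ : MvPolynomial ℕ+ ℂ →ₐ[ℂ] Fock => φ f) h

theorem bijective_creationHomPair
    (hα : ∀ n, IsUnit (Matrix.of fun i j => α i (j, n)).det) :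
    Function.Bijective (creationHomPair α) :=
  (bijective_linearHom hα).comp bijective_expHom

end Automorphism

/-! ### Pairs of partitions as exponent vectors. -/

section Partitions

theorem partCount_eq (L : List ℕ) :
    partCount L = Multiset.toFinsupp (L.map Nat.toPNat' : Multiset ℕ+) := by
  induction L with
  | nil => simp [partCount]
  | cons n L ih =>
    rw [partCount] at ih ⊢
    rw [List.map_cons, List.sum_cons, ih, List.map_cons, ← Multiset.cons_coe,
      ← Multiset.singleton_add, map_add, Multiset.toFinsupp_singleton]

theorem map_toPNat'_coe {L : List ℕ} (hL : ∀ k ∈ L, 0 < k) :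
    (L.map Nat.toPNat').map (fun k : ℕ+ => (k : ℕ)) = L := by
  rw [List.map_map]
  exact (List.map_congr_left fun k hk => by
    rw [Function.comp_apply, Nat.toPNat'_coe, if_pos (hL k hk)]; rfl).trans (List.map_id L)

theorem bijective_partCount_rowLens :
    Function.Bijective fun l : YoungDiagram => partCount l.rowLens := by
  constructor
  · intro l l' h
    simp only [partCount_eq] at h
    have h1 := (Multiset.coe_eq_coe.1 (Multiset.toFinsupp.injective h)).map fun k : ℕ+ => (k : ℕ)
    rw [map_toPNat'_coe l.pos_of_mem_rowLens, map_toPNat'_coe l'.pos_of_mem_rowLens] at h1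
    exact YoungDiagram.equivListRowLens.injective
      (Subtype.ext (h1.eq_of_pairwise' l.rowLens_sorted.pairwise l'.rowLens_sorted.pairwise))
  · intro ν
    let m : Multiset ℕ := (Finsupp.toMultiset ν).map fun k : ℕ+ => (k : ℕ)
    have hpos : ∀ k ∈ m.sort (· ≥ ·), 0 < k := by
      intro k hk
      rw [Multiset.mem_sort, Multiset.mem_map] at hk
      obtain ⟨j, -, rfl⟩ := hk
      exact j.pos
    refine ⟨YoungDiagram.ofRowLens (m.sort (· ≥ ·)) (Multiset.pairwise_sort m (· ≥ ·)).sortedGE, ?_⟩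
    simp only
    rw [YoungDiagram.rowLens_ofRowLens_eq_self hpos, partCount_eq, ← Multiset.map_coe,
      Multiset.sort_eq, Multiset.map_map]
    simp

/-- The exponent vector of a pair of partitions. -/
noncomputable def pairCount (l : YoungDiagram × YoungDiagram) : Fin 2 × ℕ+ →₀ ℕ :=
  (partCount l.1.rowLens).mapDomain (fun n => (0, n)) +
    (partCount l.2.rowLens).mapDomain fun n => (1, n)

theorem mk_injective (i : Fin 2) : Function.Injective fun n : ℕ+ => (i, n) :=
  fun _ _ h => (Prod.ext_iff.1 h).2

theorem add_mapDomain_apply (ν ν' : ℕ+ →₀ ℕ) (n : ℕ+) :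
    (ν.mapDomain (fun n => (0, n)) + ν'.mapDomain (fun n => (1, n)) : Fin 2 × ℕ+ →₀ ℕ) (0, n) = ν n ∧
    (ν.mapDomain (fun n => (0, n)) + ν'.mapDomain (fun n => (1, n)) : Fin 2 × ℕ+ →₀ ℕ) (1, n) =
      ν' n := by
  constructor
  · rw [Finsupp.add_apply, Finsupp.mapDomain_apply (mk_injective 0),
      Finsupp.mapDomain_of_notMem_range _ _ (by simp), add_zero]
  · rw [Finsupp.add_apply, Finsupp.mapDomain_apply (mk_injective 1),
      Finsupp.mapDomain_of_notMem_range _ _ (by simp), zero_add]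

theorem bijective_pairCount : Function.Bijective pairCount := by
  constructor
  · intro l l' h
    refine Prod.ext (bijective_partCount_rowLens.1 (Finsupp.ext fun n => ?_))
      (bijective_partCount_rowLens.1 (Finsupp.ext fun n => ?_))
    · have := DFunLike.congr_fun h (0, n)
      rwa [pairCount, pairCount, (add_mapDomain_apply _ _ n).1, (add_mapDomain_apply _ _ n).1]
        at this
    · have := DFunLike.congr_fun h (1, n)
      rwa [pairCount, pairCount, (add_mapDomain_apply _ _ n).2, (add_mapDomain_apply _ _ n).2]
        at this
  · intro ν
    obtain ⟨l, hl⟩ := bijective_partCount_rowLens.2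
      (ν.comapDomain (fun n => (0, n)) (mk_injective 0).injOn)
    obtain ⟨l', hl'⟩ := bijective_partCount_rowLens.2
      (ν.comapDomain (fun n => (1, n)) (mk_injective 1).injOn)
    simp only at hl hl'
    refine ⟨(l, l'), Finsupp.ext fun ⟨i, n⟩ => ?_⟩
    rw [pairCount, hl, hl']
    fin_cases i
    · exact (add_mapDomain_apply _ _ n).1
    · exact (add_mapDomain_apply _ _ n).2

end Partitions

/-! ### The basis theorem for two vertex operators. -/

section BasisTheorem
variable (α β : Fin 2 → Fin 2 × ℕ+ → ℂ)

/-- The vector obtained by applying the modes of two vertex operators, indexed by the parts of two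
partitions, to the vacuum. -/
noncomputable def vertexKet (l : YoungDiagram × YoungDiagram) : Fock :=
  ((l.2.rowLens.map fun k : ℕ => vertex (α 1) (β 1) (-(k : ℤ))).prod *
    (l.1.rowLens.map fun k : ℕ => vertex (α 0) (β 0) (-(k : ℤ))).prod) 1

variable {α β}

theorem shift_creationHom {α β : Fin 2 × ℕ+ → ℂ} (h : ∀ n, ∑ i, β (i, n) * α (i, n) = 0)
    (f : MvPolynomial ℕ+ ℂ) : shift β (creationHom α f) = Polynomial.C (creationHom α f) := by
  have h1 : (shift β).comp (creationHom α) =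
      (Polynomial.CAlgHom (R := ℂ) (A := Fock)).comp (creationHom α) := by
    refine MvPolynomial.algHom_ext fun n => ?_
    rw [AlgHom.comp_apply, AlgHom.comp_apply, creationHom_X,
      shift_creationCoeff β α (show ((n : ℕ) : ℤ) < ((n : ℕ) + 1 : ℕ) by omega),
      exchangeFactor_eq_one h, Finset.sum_range_succ', Finset.sum_eq_zero]
    · simp
    · intro j _
      simp [PowerSeries.coeff_one]
  exact congrArg (fun φ : MvPolynomial ℕ+ ℂ →ₐ[ℂ] Polynomial Fock => φ f) h1

/-- Orthogonality of the exponents makes the exchange factor trivial, so the translation fixes every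
E_k of the other operator. -/
theorem vertex_creationHom_mul {α α' β : Fin 2 × ℕ+ → ℂ}
    (h : ∀ n, ∑ i, β (i, n) * α' (i, n) = 0) (n : ℤ) (f : MvPolynomial ℕ+ ℂ) (v : Fock) :
    vertex α β n (creationHom α' f * v) = creationHom α' f * vertex α β n v := by
  rw [vertex_apply, map_mul, shift_creationHom h, ← Polynomial.smul_eq_C_mul, map_smul, smul_eq_mul,
    vertex_apply]

theorem prod_vertex_creationHom {α α' β : Fin 2 × ℕ+ → ℂ}
    (h : ∀ n, ∑ i, β (i, n) * α' (i, n) = 0) (L : List ℕ) (f : MvPolynomial ℕ+ ℂ) (v : Fock) :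
    (L.map fun k : ℕ => vertex α β (-(k : ℤ))).prod (creationHom α' f * v) =
      creationHom α' f * (L.map fun k : ℕ => vertex α β (-(k : ℤ))).prod v := by
  induction L with
  | nil => simp
  | cons k L ih =>
    rw [List.map_cons, List.prod_cons, Module.End.mul_apply, Module.End.mul_apply, ih,
      vertex_creationHom_mul h]

/-- An injective numbering of the variables of the Fock space that increases with `n`. -/
def varOrder (x : Fin 2 × ℕ+) : ℕ := 2 * x.2 + x.1

theorem varOrder_injective : Function.Injective varOrder := by
  rintro ⟨i, n⟩ ⟨j, m⟩ h
  simp only [varOrder] at h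
  have h1 := i.isLt
  have h2 := j.isLt
  exact Prod.ext (Fin.ext (by simp only; omega)) (PNat.eq (by simp only; omega))

theorem strictMono_varOrder (i : Fin 2) : StrictMono (varOrder ∘ fun n => (i, n)) := by
  intro n m h
  have h : (n : ℕ) < m := h
  simp only [Function.comp_apply, varOrder]
  omega

/-- By orthogonality the second operator passes the polynomial produced by the first, so the vector
is a product of two triangular polynomials in separate sets of generators. -/
theorem exists_isTriangular_vertexKet (h : ∀ n, ∑ i, β 1 (i, n) * α 0 (i, n) = 0)
    (l : YoungDiagram × YoungDiagram) :
    ∃ f, IsTriangular varOrder (fun x => (x.2 : ℕ)) (pairCount l) f ∧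
      vertexKet α β l = creationHomPair α f := by
  obtain ⟨f, hf, hf'⟩ := exists_isTriangular_prod (α := α 0) (β := β 0) (strictMono_varOrder 0)
    l.1.rowLens_sorted l.1.pos_of_mem_rowLens
  obtain ⟨g, hg, hg'⟩ := exists_isTriangular_prod (α := α 1) (β := β 1) (strictMono_varOrder 1)
    l.2.rowLens_sorted l.2.pos_of_mem_rowLens
  have hf₁ : IsTriangular varOrder (fun x => (x.2 : ℕ)) _ _ := IsTriangular.rename (mk_injective 0) hf
  have hg₁ : IsTriangular varOrder (fun x => (x.2 : ℕ)) _ _ := IsTriangular.rename (mk_injective 1) hg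
  refine ⟨_, hf₁.mul varOrder_injective hg₁, ?_⟩
  rw [map_mul, creationHomPair_rename, creationHomPair_rename, vertexKet, Module.End.mul_apply, hf',
    ← mul_one (creationHom (α 0) f), prod_vertex_creationHom h, hg', mul_one]

/-- Products of modes of two vertex operators, applied to the vacuum, form a basis. -/
theorem vertexKet_basis (hα : ∀ n, IsUnit (Matrix.of fun i j => α i (j, n)).det)
    (h : ∀ n, ∑ i, β 1 (i, n) * α 0 (i, n) = 0) :
    LinearIndependent ℂ (vertexKet α β) ∧
      Submodule.span ℂ (Set.range (vertexKet α β)) = ⊤ := by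
  choose f hf hf' using exists_isTriangular_vertexKet (α := α) (β := β) h
  have h1 : vertexKet α β = (creationHomPair α).toLinearMap ∘ f := funext hf'
  have hbij := bijective_creationHomPair α hα
  rw [h1]
  constructor
  · exact (linearIndependent_of_isTriangular varOrder_injective bijective_pairCount.1 hf).map'
      _ (LinearMap.ker_eq_bot.2 hbij.1)
  · rw [Set.range_comp, ← Submodule.map_span, span_of_isTriangular varOrder_injective ?_ ?_
      bijective_pairCount.2 hf, Submodule.map_top, LinearMap.range_eq_top.2 hbij.2]
    · intro d
      -- The bound d + 1 is used because it is a positive integer even for d = 0.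
      refine (Set.finite_univ.prod (Set.finite_Iic (Nat.succPNat d))).subset ?_
      rintro ⟨i, n⟩ hn
      refine ⟨trivial, ?_⟩
      have hn : (n : ℕ) ≤ d := hn
      rw [Set.mem_Iic, ← PNat.coe_le_coe, Nat.succPNat_coe]
      exact Nat.le_succ_of_le hn
    · exact fun x => x.2.ne_zero

end BasisTheorem

/-! ### The Fischer form and adjoints of vertex operators. -/

section Fischer

/-- The product of the factorials of the exponents. -/
noncomputable def expFactorial (μ : Fin 2 × ℕ+ →₀ ℕ) : ℂ := μ.prod fun _ k => (Nat.factorial k : ℂ)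

theorem expFactorial_ne_zero (μ : Fin 2 × ℕ+ →₀ ℕ) : expFactorial μ ≠ 0 :=
  Finset.prod_ne_zero_iff.2 fun _ _ => Nat.cast_ne_zero.2 (Nat.factorial_ne_zero _)

theorem expFactorial_add_single (μ : Fin 2 × ℕ+ →₀ ℕ) (x : Fin 2 × ℕ+) :
    expFactorial (μ + Finsupp.single x 1) = (μ x + 1) * expFactorial μ := by
  rw [expFactorial, expFactorial, ← Finsupp.mul_prod_erase' _ x _ (by simp),
    ← Finsupp.mul_prod_erase' μ x _ (by simp)]
  have h1 : (μ + Finsupp.single x 1).erase x = μ.erase x := by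
    rw [Finsupp.erase_add, Finsupp.erase_single, add_zero]
  rw [h1, Finsupp.add_apply, Finsupp.single_eq_same, Nat.factorial_succ]
  push_cast
  ring

/-- The Fischer form `⟨f, v⟩ = ∑_μ μ! f_μ v_μ`, for which `x_{i,n}` and `∂_{i,n}` are adjoint. -/
noncomputable def fischer : Fock →ₗ[ℂ] Module.Dual ℂ Fock :=
  (MvPolynomial.basisMonomials (Fin 2 × ℕ+) ℂ).constr ℂ fun μ =>
    expFactorial μ • MvPolynomial.lcoeff ℂ μ

theorem fischer_monomial (μ : Fin 2 × ℕ+ →₀ ℕ) (v : Fock) :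
    fischer (MvPolynomial.monomial μ 1) v = expFactorial μ * v.coeff μ := by
  have h := (MvPolynomial.basisMonomials (Fin 2 × ℕ+) ℂ).constr_basis ℂ (fun μ =>
    expFactorial μ • MvPolynomial.lcoeff ℂ μ) μ
  rw [MvPolynomial.coe_basisMonomials] at h
  rw [fischer, h]
  rfl

theorem fock_induction {p : Fock → Prop} (hadd : ∀ f g, p f → p g → p (f + g))
    (hsmul : ∀ (c : ℂ) f, p f → p (c • f)) (hmon : ∀ μ, p (MvPolynomial.monomial μ 1)) (f : Fock) :
    p f := by
  induction f using MvPolynomial.induction_on' with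
  | monomial μ a => simpa [MvPolynomial.smul_monomial] using hsmul a _ (hmon μ)
  | add f g hf hg => exact hadd f g hf hg

theorem fischer_comm (f v : Fock) : fischer f v = fischer v f := by
  classical
  induction f using fock_induction with
  | hadd f g hf hg => rw [map_add, map_add, LinearMap.add_apply, hf, hg]
  | hsmul c f hf => rw [map_smul, map_smul, LinearMap.smul_apply, hf]
  | hmon μ =>
    induction v using fock_induction with
    | hadd f g hf hg => rw [map_add, map_add, LinearMap.add_apply, hf, hg]
    | hsmul c f hf => rw [map_smul, map_smul, LinearMap.smul_apply, hf]
    | hmon ν =>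
      rw [fischer_monomial, fischer_monomial, MvPolynomial.coeff_monomial,
        MvPolynomial.coeff_monomial]
      rcases eq_or_ne μ ν with rfl | h
      · rfl
      · rw [if_neg h, if_neg h.symm, mul_zero, mul_zero]

theorem fischer_one : fischer 1 = braVac := by
  refine LinearMap.ext fun v => ?_
  rw [← MvPolynomial.C_1, ← MvPolynomial.monomial_zero', fischer_monomial]
  simp [expFactorial, braVac]

theorem ker_fischer : LinearMap.ker fischer = ⊥ := by
  rw [LinearMap.ker_eq_bot']
  intro f hf
  refine MvPolynomial.ext _ _ fun μ => ?_
  have h1 := LinearMap.congr_fun hf (MvPolynomial.monomial μ 1)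
  rw [fischer_comm, fischer_monomial, LinearMap.zero_apply] at h1
  exact (mul_eq_zero.1 h1).resolve_left (expFactorial_ne_zero μ)

/-- The operators `A` and `B` are adjoint with respect to the Fischer form. -/
def IsFischerAdjoint (A B : Op) : Prop := ∀ f v, fischer (A f) v = fischer f (B v)

theorem IsFischerAdjoint.symm {A B : Op} (h : IsFischerAdjoint A B) : IsFischerAdjoint B A :=
  fun f v => by rw [fischer_comm, ← h, fischer_comm]

theorem IsFischerAdjoint.mul {A B A' B' : Op} (h : IsFischerAdjoint A B)
    (h' : IsFischerAdjoint A' B') : IsFischerAdjoint (A * A') (B' * B) := fun f v => by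
  rw [Module.End.mul_apply, Module.End.mul_apply, h, h']

theorem IsFischerAdjoint.smul {A B : Op} (h : IsFischerAdjoint A B) (c : ℂ) :
    IsFischerAdjoint (c • A) (c • B) := fun f v => by
  rw [LinearMap.smul_apply, LinearMap.smul_apply, map_smul, map_smul, LinearMap.smul_apply, h]

theorem IsFischerAdjoint.sum {ι : Type*} (S : Finset ι) {A B : ι → Op}
    (h : ∀ i ∈ S, IsFischerAdjoint (A i) (B i)) :
    IsFischerAdjoint (∑ i ∈ S, A i) (∑ i ∈ S, B i) := fun f v => by
  simp only [LinearMap.sum_apply, map_sum]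
  exact Finset.sum_congr rfl fun i hi => h i hi f v

theorem isFischerAdjoint_zero : IsFischerAdjoint 0 0 := fun f v => by simp

theorem isFischerAdjoint_one : IsFischerAdjoint 1 1 := fun _ _ => rfl

theorem IsFischerAdjoint.list_prod {L : List ℕ} {A B : ℕ → Op}
    (h : ∀ k ∈ L, IsFischerAdjoint (A k) (B k)) :
    IsFischerAdjoint (L.map A).prod (L.reverse.map B).prod := by
  induction L with
  | nil => simpa using isFischerAdjoint_one
  | cons k L ih =>
    rw [List.map_cons, List.prod_cons, List.reverse_cons, List.map_append, List.prod_append]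
    simpa using (h k (by simp)).mul (ih fun j hj => h j (by simp [hj]))

theorem isFischerAdjoint_X (x : Fin 2 × ℕ+) :
    IsFischerAdjoint (Algebra.lmul ℂ Fock (MvPolynomial.X x))
      (MvPolynomial.pderiv (R := ℂ) x).toLinearMap := by
  intro f v
  induction f using fock_induction with
  | hadd f g hf hg =>
    rw [map_add, map_add, map_add, LinearMap.add_apply, LinearMap.add_apply, hf, hg]
  | hsmul c f hf =>
    rw [map_smul, map_smul, map_smul, LinearMap.smul_apply, LinearMap.smul_apply, hf]
  | hmon μ =>
    induction v using fock_induction with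
    | hadd f g hf hg => rw [map_add, map_add, map_add, hf, hg]
    | hsmul c f hf => rw [map_smul, map_smul, map_smul, hf]
    | hmon ν =>
      classical
      have h1 : Algebra.lmul ℂ Fock (MvPolynomial.X x) (MvPolynomial.monomial μ 1) =
          MvPolynomial.monomial (μ + Finsupp.single x 1) 1 := by
        rw [Algebra.coe_lmul_eq_mul, LinearMap.mul_apply', MvPolynomial.X,
          MvPolynomial.monomial_mul, one_mul, add_comm]
      have h2 : (MvPolynomial.pderiv (R := ℂ) x).toLinearMap (MvPolynomial.monomial ν 1) =
          MvPolynomial.monomial (ν - Finsupp.single x 1) (ν x : ℂ) := by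
        refine (MvPolynomial.pderiv_monomial (R := ℂ) (i := x)).trans ?_
        rw [one_mul]
      rw [h1, h2, fischer_monomial, fischer_monomial, MvPolynomial.coeff_monomial,
        MvPolynomial.coeff_monomial, expFactorial_add_single]
      by_cases h : ν = μ + Finsupp.single x 1
      · subst h
        simp
        ring
      · rw [if_neg h, mul_zero]
        split_ifs with h3
        · have h4 : ν x = 0 := by
            by_contra h5
            refine h ?_
            rw [← h3, tsub_add_cancel_of_le]
            exact Finsupp.single_le_iff.2 (Nat.one_le_iff_ne_zero.2 h5)
          rw [h4, Nat.cast_zero, mul_zero]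
        · rw [mul_zero]

theorem IsFischerAdjoint.coeff_pow {g h : PowerSeries Op}
    (H : ∀ n, IsFischerAdjoint (PowerSeries.coeff n g) (PowerSeries.coeff n h)) (k n : ℕ) :
    IsFischerAdjoint (PowerSeries.coeff n (g ^ k)) (PowerSeries.coeff n (h ^ k)) := by
  induction k generalizing n with
  | zero =>
    rw [pow_zero, pow_zero, PowerSeries.coeff_one]
    split_ifs
    · exact isFischerAdjoint_one
    · exact isFischerAdjoint_zero
  | succ k ih =>
    -- Adjoints reverse products, so the new factor is split off on opposite sides and the
    -- antidiagonal is swapped.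
    rw [pow_succ, pow_succ', PowerSeries.coeff_mul, PowerSeries.coeff_mul,
      ← Finset.Nat.sum_antidiagonal_swap]
    exact IsFischerAdjoint.sum _ fun x _ => (ih x.2).mul (H x.1)

theorem IsFischerAdjoint.coeff_pexp {g h : PowerSeries Op}
    (H : ∀ n, IsFischerAdjoint (PowerSeries.coeff n g) (PowerSeries.coeff n h)) (n : ℕ) :
    IsFischerAdjoint (PowerSeries.coeff n (pexp g)) (PowerSeries.coeff n (pexp h)) := by
  rw [pexp, pexp, PowerSeries.coeff_mk, PowerSeries.coeff_mk]
  exact IsFischerAdjoint.sum _ fun k _ => (IsFischerAdjoint.coeff_pow H k n).smul _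

theorem fischer_creation_mul (β : Fin 2 × ℕ+ → ℂ) (n : ℕ) (f v : Fock) :
    fischer (PowerSeries.coeff n (creationSeries β) * f) v =
      fischer f ((shift β v).coeff n) := by
  have h := IsFischerAdjoint.coeff_pexp
    (g := mixedCurrent β fun x => Algebra.lmul ℂ Fock (MvPolynomial.X x))
    (h := mixedCurrent β fun x => (MvPolynomial.pderiv (R := ℂ) x).toLinearMap) (fun n => ?_) n f v
  · rw [show PowerSeries.coeff n (pexp (mixedCurrent β fun x =>
        (MvPolynomial.pderiv (R := ℂ) x).toLinearMap)) v = (shift β v).coeff n from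
      coeff_pexp_pderiv β n v] at h
    rw [← h, ← map_mixedCurrent (Algebra.lmul ℂ Fock) β MvPolynomial.X, ← map_pexp]
    rfl
  · rcases Nat.eq_zero_or_pos n with rfl | hn
    · rw [coeff_zero_mixedCurrent, coeff_zero_mixedCurrent]
      exact isFischerAdjoint_zero
    · lift n to ℕ+ using hn
      rw [coeff_mixedCurrent, coeff_mixedCurrent]
      exact IsFischerAdjoint.sum _ fun i _ => (isFischerAdjoint_X _).smul _

theorem fischer_mul_creationCoeff (α : Fin 2 × ℕ+ → ℂ) (k : ℤ) (f w : Fock) {M : ℕ}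
    (hM : (shift α f).natDegree < M) :
    fischer f (creationCoeff α k * w) =
      ∑ a ∈ Finset.range M, if (a : ℤ) = k then fischer ((shift α f).coeff a) w else 0 := by
  rcases lt_or_ge k 0 with hk | hk
  · rw [creationCoeff_of_neg α hk, zero_mul, map_zero, Finset.sum_eq_zero]
    intro a _
    rw [if_neg (by omega)]
  · lift k to ℕ using hk
    simp only [Nat.cast_inj, Finset.sum_ite_eq', Finset.mem_range]
    rw [creationCoeff_natCast, fischer_comm, fischer_creation_mul, fischer_comm]
    split_ifs with h
    · rfl
    · rw [Polynomial.coeff_eq_zero_of_natDegree_lt (by omega), map_zero, LinearMap.zero_apply]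

theorem fischer_vertex (α β : Fin 2 × ℕ+ → ℂ) (n : ℤ) (f v : Fock) {N M : ℕ}
    (hN : (shift β v).natDegree < N) (hM : (shift α f).natDegree < M) :
    fischer f (vertex α β n v) = ∑ b ∈ Finset.range N, ∑ a ∈ Finset.range M,
      if (a : ℤ) = b - n then fischer ((shift α f).coeff a) ((shift β v).coeff b) else 0 := by
  rw [vertex_apply, contract_eq_sum_range _ _ _ hN, map_sum]
  exact Finset.sum_congr rfl fun b _ => fischer_mul_creationCoeff α _ f _ hM

/-- Multiplication by the creation series is adjoint to translation with the same exponents, so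
taking adjoints exchanges the two halves and inverts z. -/
theorem isFischerAdjoint_vertex (α β : Fin 2 × ℕ+ → ℂ) (n : ℤ) :
    IsFischerAdjoint (vertex β α (-n)) (vertex α β n) := by
  intro f v
  rw [fischer_comm, fischer_vertex β α (-n) v f (Nat.lt_succ_self _) (Nat.lt_succ_self _),
    fischer_vertex α β n f v (Nat.lt_succ_self _) (Nat.lt_succ_self _), Finset.sum_comm]
  refine Finset.sum_congr rfl fun b _ => Finset.sum_congr rfl fun a _ => ?_
  rw [fischer_comm]
  exact if_congr (by omega) rfl rfl

end Fischer

/-! ### The dual Fock module as the image of the Fischer form. -/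

section FockDual
variable {t : ℂ}

theorem isFischerAdjoint_creation (x : Fin 2 × ℕ+) :
    IsFischerAdjoint (creation x.1 x.2) (MvPolynomial.pderiv (R := ℂ) x).toLinearMap := by
  rw [creation_eq_lmul]
  exact isFischerAdjoint_X x

theorem exists_smul_annihilation (ht : ∀ n : ℕ, 0 < n → t ^ n ≠ 1) (x : Fin 2 × ℕ+) :
    ∃ c : ℂ, c • annihilation t 0 x.1 x.2 = (MvPolynomial.pderiv (R := ℂ) x).toLinearMap := by
  have h1 : 1 - t ^ (x.2 : ℕ) ≠ 0 := sub_ne_zero.2 (ht _ x.2.pos).symm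
  have h2 : ((x.2 : ℕ) : ℂ) ≠ 0 := Nat.cast_ne_zero.2 x.2.ne_zero
  refine ⟨(1 - t ^ (x.2 : ℕ)) / (x.2 : ℕ), ?_⟩
  rw [annihilation, smul_smul, zero_pow x.2.ne_zero, sub_zero, mul_one, div_mul_div_cancel₀' h1,
    div_self h2, one_smul]

/-- The adjoints of the generators keep the image of the form stable. Conversely, multiplication of
`f` by a variable is realized by an annihilation operator at q = 0, which is a nonzero multiple of a
derivative. -/
theorem fockDual_eq_range (ht : ∀ n : ℕ, 0 < n → t ^ n ≠ 1) :
    FockDual t = LinearMap.range fischer := by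
  apply le_antisymm
  · rw [FockDual, Submodule.map_le_iff_le_comap]
    intro A hA
    -- The claim is needed for every `f`, not just 1, to pass through products of operators.
    suffices H : ∀ f, ∃ g, fischer f ∘ₗ A = fischer g by
      obtain ⟨g, hg⟩ := H 1
      refine ⟨g, ?_⟩
      rw [← hg, fischer_one]
      rfl
    rw [Subalgebra.mem_toSubmodule] at hA
    induction hA using Algebra.adjoin_induction with
    | mem A hA =>
      intro f
      rcases hA with ⟨x, rfl⟩ | ⟨x, rfl⟩
      · exact ⟨_, LinearMap.ext fun v => ((isFischerAdjoint_creation x).symm f v).symm⟩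
      · exact ⟨_, LinearMap.ext fun v => (((isFischerAdjoint_X x).smul _) f v).symm⟩
    | algebraMap c =>
      exact fun f => ⟨c • f, LinearMap.ext fun v => by
        rw [LinearMap.comp_apply, Module.algebraMap_end_apply, map_smul, map_smul,
          LinearMap.smul_apply]⟩
    | add A B _ _ hA hB =>
      intro f
      obtain ⟨g, hg⟩ := hA f
      obtain ⟨h, hh⟩ := hB f
      exact ⟨g + h, by rw [LinearMap.comp_add, hg, hh, map_add]⟩
    | mul A B _ _ hA hB =>
      intro f
      obtain ⟨g, hg⟩ := hA f
      obtain ⟨h, hh⟩ := hB g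
      exact ⟨h, by rw [← hh, ← hg]; rfl⟩
  · rintro _ ⟨f, rfl⟩
    induction f using MvPolynomial.induction_on with
    | C a =>
      rw [show (MvPolynomial.C a : Fock) = a • 1 by rw [MvPolynomial.smul_eq_C_mul, mul_one],
        map_smul, fischer_one]
      have h1 : (braVac : Fock →ₗ[ℂ] ℂ) ∈ FockDual t := by
        rw [FockDual, Submodule.mem_map]
        refine ⟨1, ?_, LinearMap.ext fun _ => rfl⟩
        exact one_mem (Algebra.adjoin ℂ _)
      exact Submodule.smul_mem _ _ h1
    | add f g hf hg =>
      rw [map_add]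
      exact Submodule.add_mem _ hf hg
    | mul_X f x hf =>
      obtain ⟨A, hA, hAf⟩ := hf
      obtain ⟨c, hc⟩ := exists_smul_annihilation ht x
      refine ⟨A * (c • annihilation t 0 x.1 x.2), ?_, ?_⟩
      · refine Subalgebra.mul_mem _ hA (Subalgebra.smul_mem _ (Algebra.subset_adjoin ?_) c)
        exact Or.inr ⟨x, rfl⟩
      refine LinearMap.ext fun v => ?_
      rw [hc, mul_comm]
      refine Eq.trans ?_ (isFischerAdjoint_X x f v).symm
      rw [← hAf]
      rfl

end FockDual

/-! ### The crystallized vectors as rescaled vertex operator vectors. -/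

section Main

theorem list_prod_smul {L : List ℕ} {A B : ℕ → Op} {c : ℂ} (h : ∀ k ∈ L, A k = c • B k) :
    (L.map A).prod = c ^ L.length • (L.map B).prod := by
  induction L with
  | nil => simp
  | cons k L ih =>
    rw [List.map_cons, List.prod_cons, List.map_cons, List.prod_cons, h k (by simp),
      ih fun j hj => h j (by simp [hj]), smul_mul_smul_comm, List.length_cons, pow_succ']

/-- Rescaling of a basis by nonzero scalars. -/
theorem basis_smul {ι V : Type*} [AddCommGroup V] [Module ℂ V] {b b' : ι → V} {c : ι → ℂ}
    (hc : ∀ i, c i ≠ 0) (h : ∀ i, b' i = c i • b i)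
    (hb : LinearIndependent ℂ b ∧ Submodule.span ℂ (Set.range b) = ⊤) :
    LinearIndependent ℂ b' ∧ Submodule.span ℂ (Set.range b') = ⊤ := by
  let B := (Module.Basis.mk hb.1 hb.2.ge).unitsSMul fun i => Units.mk0 (c i) (hc i)
  have h1 : b' = B := funext fun i => by
    rw [h, Module.Basis.unitsSMul_apply, Module.Basis.mk_apply]
    rfl
  rw [h1]
  exact ⟨B.linearIndependent, B.span_eq⟩

variable {t : ℂ} {u : Fin 2 → ℂ}

theorem cN_ne_zero (ht : ∀ n : ℕ, 0 < n → t ^ n ≠ 1) (n : ℕ+) : cN t n ≠ 0 := by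
  refine div_ne_zero (sub_ne_zero.2 fun h => ht n n.pos ?_) (Nat.cast_ne_zero.2 n.ne_zero)
  rw [← inv_inv (t ^ (n : ℕ)), ← h, inv_one]

theorem crysX1_neg {k : ℕ} (hk : 0 < k) :
    crysX1 t u (-(k : ℤ)) = u 1 • vertex (crysTwoC t) crysTwoA (-(k : ℤ)) := by
  rw [crysX1, if_neg (by omega), if_pos (by omega), mul_zero, zero_smul, zero_add, mul_one]

theorem crysX1_pos {k : ℕ} (hk : 0 < k) :
    crysX1 t u k = u 0 • vertex (crysOneC t) crysOneA k := by
  rw [crysX1, if_pos (by omega), if_neg (by omega), mul_zero, zero_smul, add_zero, mul_one]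

/-- All parts are positive, so only the Λ² term of X̃^{(1)} occurs. -/
theorem pbwKet_crys (t : ℂ) (u : Fin 2 → ℂ) (l : YoungDiagram × YoungDiagram) :
    pbwKet (crysX1 t u) (crysX2 t u) l =
      ((u 1 * u 0) ^ l.2.rowLens.length * u 1 ^ l.1.rowLens.length) •
        vertexKet ![crysTwoC t, crysThreeC t] ![crysTwoA, crysThreeA] l := by
  rw [pbwKet, list_prod_smul (c := u 1 * u 0)
      (A := fun k => crysX2 t u (-(k : ℤ)))
      (B := fun k => vertex (crysThreeC t) crysThreeA (-(k : ℤ))) (fun k _ => rfl),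
    list_prod_smul (A := fun k => crysX1 t u (-(k : ℤ))) (fun k hk => crysX1_neg (l.1.pos_of_mem_rowLens k hk)), smul_mul_smul_comm]
  rfl

/-- Only the Λ¹ term occurs at positive indices. Taking adjoints reverses the product and exchanges
creation and annihilation exponents. -/
theorem pbwBra_crys (t : ℂ) (u : Fin 2 → ℂ) (l : YoungDiagram × YoungDiagram) :
    pbwBra (crysX1 t u) (crysX2 t u) l =
      fischer (((u 1 * u 0) ^ l.2.rowLens.length * u 0 ^ l.1.rowLens.length) •
        vertexKet ![crysOneA, crysThreeA] ![crysOneC t, crysThreeC t] l) := by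
  have h2 : IsFischerAdjoint
      (l.2.rowLens.map fun k : ℕ => (u 1 * u 0) • vertex crysThreeA (crysThreeC t) (-(k : ℤ))).prod
      (l.2.rowLens.reverse.map fun k : ℕ => crysX2 t u (k : ℤ)).prod :=
    IsFischerAdjoint.list_prod fun k _ => (isFischerAdjoint_vertex _ _ _).smul _
  have h1 : IsFischerAdjoint
      (l.1.rowLens.map fun k : ℕ => u 0 • vertex crysOneA (crysOneC t) (-(k : ℤ))).prod
      (l.1.rowLens.reverse.map fun k : ℕ => crysX1 t u (k : ℤ)).prod :=
    IsFischerAdjoint.list_prod fun k hk => by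
      rw [crysX1_pos (l.1.pos_of_mem_rowLens k hk)]
      exact (isFischerAdjoint_vertex _ _ _).smul _
  refine LinearMap.ext fun v => ?_
  rw [pbwBra, ← fischer_one, LinearMap.comp_apply, ← (h2.mul h1) 1 v,
    list_prod_smul (c := u 1 * u 0) (fun k _ => rfl), list_prod_smul (c := u 0) (fun k _ => rfl),
    smul_mul_smul_comm]
  rfl

end Main

end CrystalPBW

theorem mainTheorem3 (t : ℂ) (ht0 : t ≠ 0) (ht : ∀ n : ℕ, 0 < n → t ^ n ≠ 1)
    (u : Fin 2 → ℂ) (hu : ∀ i, u i ≠ 0) :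
    (∃! Y : (ℤ → CrystalPBW.Op) × (ℤ → CrystalPBW.Op),
      CrystalPBW.IsCrystallization t u Y.1 Y.2) ∧
    ∀ Y1 Y2 : ℤ → CrystalPBW.Op, CrystalPBW.IsCrystallization t u Y1 Y2 →
      (LinearIndependent ℂ (CrystalPBW.pbwKet Y1 Y2) ∧
        Submodule.span ℂ (Set.range (CrystalPBW.pbwKet Y1 Y2)) = ⊤) ∧
      (LinearIndependent ℂ (CrystalPBW.pbwBra Y1 Y2) ∧
        Submodule.span ℂ (Set.range (CrystalPBW.pbwBra Y1 Y2)) = CrystalPBW.FockDual t) := by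
  have hcrys := CrystalPBW.isCrystallization_crys ht0 ht u
  refine ⟨⟨(CrystalPBW.crysX1 t u, CrystalPBW.crysX2 t u), hcrys, fun Y hY =>
    Prod.ext (hY.unique hcrys).1 (hY.unique hcrys).2⟩, fun Y1 Y2 hY => ?_⟩
  obtain ⟨rfl, rfl⟩ := hY.unique hcrys
  constructor
  · refine CrystalPBW.basis_smul (fun l => ?_) (CrystalPBW.pbwKet_crys t u)
      (CrystalPBW.vertexKet_basis (fun n => ?_) fun n => ?_)
    · exact mul_ne_zero (pow_ne_zero _ (mul_ne_zero (hu 1) (hu 0))) (pow_ne_zero _ (hu 1))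
    -- The rows are (-c, c) and (0, c) with c = (1 - t^{-n})/n ≠ 0; the determinant is -c².
    · have := CrystalPBW.cN_ne_zero ht n
      simp [Matrix.det_fin_two, CrystalPBW.crysTwoC, CrystalPBW.crysThreeC, this]
    -- Orthogonality of (-1, -1) and (-c, c).
    · simp [CrystalPBW.crysTwoC, CrystalPBW.crysThreeA]
  · have hb := CrystalPBW.basis_smul (b' := fun l =>
      ((u 1 * u 0) ^ l.2.rowLens.length * u 0 ^ l.1.rowLens.length) • CrystalPBW.vertexKet
        ![CrystalPBW.crysOneA, CrystalPBW.crysThreeA]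
        ![CrystalPBW.crysOneC t, CrystalPBW.crysThreeC t] l)
      (fun l => mul_ne_zero (pow_ne_zero _ (mul_ne_zero (hu 1) (hu 0))) (pow_ne_zero _ (hu 0)))
      (fun l => rfl) (CrystalPBW.vertexKet_basis (fun n => ?_) fun n => ?_)
    · have h1 : CrystalPBW.pbwBra (CrystalPBW.crysX1 t u) (CrystalPBW.crysX2 t u) =
          CrystalPBW.fischer ∘ _ := funext (CrystalPBW.pbwBra_crys t u)
      rw [h1, Set.range_comp, ← Submodule.map_span, hb.2, Submodule.map_top,
        CrystalPBW.fockDual_eq_range ht]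
      exact ⟨hb.1.map' _ CrystalPBW.ker_fischer, rfl⟩
    -- On the dual side the rows are (-1, 0) and (-1, -1), with determinant 1; below, (0, c) is
    -- orthogonal to (-1, 0).
    · simp [Matrix.det_fin_two, CrystalPBW.crysOneA, CrystalPBW.crysThreeA]
    · simp [CrystalPBW.crysOneA, CrystalPBW.crysThreeC]
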